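/- Let $m\ge 0$ and let $K$ be an abstract simplicial complex on the vertex set $\{1,\dots,m\}$, with every singleton $\{i\}$ a face of $K$. Let $$RC_K=F(a_1,\dots,a_m)\big/\bigl(a_i^2=1,\ a_ia_j=a_ja_i\text{ for }\{i,j\}\in K\bigr)$$ be the corresponding right-angled Coxeter group. A 2-Lie algebra (restricted Lie algebra) over $\mathbb Z_2=\mathbb Z/2$ is a Lie algebra $L$ over $\mathbb Z_2$ with an operation $x\mapsto x^{[2]}$ such that $[x,y^{[2]}]=[[x,y],y]$, $(\alpha x)^{[2]}=\alpha^2x^{[2]}$ and $(x+y)^{[2]}=x^{[2]}+y^{[2]}+[x,y]$ for $x,y\in L$, $\alpha\in\mathbb Z_2$. Let $FL_2(u_1,\dots,u_m)$ be the free 2-Lie algebra over $\mathbb Z_2$ on $u_1,\dots,u_m$. Write $(g,h)=g^{-1}h^{-1}gh$. A 2-central series on a group $G$ is a sequence of subgroups $G=\Gamma_1\supset\Gamma_2\supset\cdots$ such that $(\Gamma_k,\Gamma_l)\subset\Gamma_{k+l}$ for all $k,l\ge1$, and $g^2\in\Gamma_{2k}$ whenever $g\in\Gamma_k$, $k\ge1$.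 The lower 2-central series $\gamma^{[2]}(G)$ is the smallest one: $\gamma^{[2]}_k(G)\subset\Gamma_k$ for every 2-central series $\Gamma$ on $G$ and every $k$. The associated graded $\mathbb Z_2$-module $$\mathrm{gr}_\bullet\gamma^{[2]}(G)=\bigoplus_{k\ge1}\gamma^{[2]}_k(G)/\gamma^{[2]}_{k+1}(G)$$ is a 2-Lie algebra over $\mathbb Z_2$ with the operations determined by $[\overline g,\overline h]=\overline{(g,h)}$ in degree $k+l$ and $\overline g^{\,[2]}=\overline{g^2}$ in degree $2k$, for $g\in\gamma^{[2]}_k(G)$ and $h\in\gamma^{[2]}_l(G)$. Then there is an isomorphism of 2-Lie algebras over $\mathbb Z_2$ $$\mathrm{gr}_\bullet\gamma^{[2]}(RC_K)\;\cong\;FL_2(u_1,\dots,u_m)\big/\bigl(u_i^{[2]}=0\ (1\le i\le m),\ [u_i,u_j]=0\text{ for }\{i,j\}\in K\bigr),$$ where the right-hand side is the quotient by the ideal (a Lie ideal closed under $x\mapsto x^{[2]}$) generated by the listed elements. -/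

import Mathlib

open scoped DirectSum

/-! ### Restricted Lie algebras over the field of two elements -/

/-- A 2-Lie algebra (restricted Lie algebra for the prime `2`) over `ZMod 2`: a Lie algebra with a
2-power operation `sq`, written `x ↦ x^[2]`. For `p = 2` the additivity defect of the `p`-power
operation is the single term `s₁(x, y) = [x, y]`. -/
class TwoLieAlgebra (L : Type*) [LieRing L] [LieAlgebra (ZMod 2) L] where
  /-- the 2-power operation -/
  sq : L → L
  lie_sq : ∀ x y : L, ⁅x, sq y⁆ = ⁅⁅x, y⁆, y⁆
  sq_smul : ∀ (a : ZMod 2) (x : L), sq (a • x) = a ^ 2 • sq x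
  sq_add : ∀ x y : L, sq (x + y) = sq x + sq y + ⁅x, y⁆

/-- An ideal of a 2-Lie algebra: a Lie ideal closed under the 2-power operation. -/
structure TwoLieIdeal (L : Type*) [LieRing L] [LieAlgebra (ZMod 2) L] [TwoLieAlgebra L]
    extends LieIdeal (ZMod 2) L where
  sq_mem : ∀ x ∈ toLieSubmodule, TwoLieAlgebra.sq x ∈ toLieSubmodule

/-- The quotient of a 2-Lie algebra by an ideal. -/
def TwoLieIdeal.Quot {L : Type*} [LieRing L] [LieAlgebra (ZMod 2) L] [TwoLieAlgebra L]
    (I : TwoLieIdeal L) : Type _ :=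
  L ⧸ I.toLieSubmodule

namespace TwoLieIdeal

section

variable {L : Type*} [LieRing L] [LieAlgebra (ZMod 2) L] [TwoLieAlgebra L]

/-- The 2-Lie ideal generated by a set: the intersection of all 2-Lie ideals containing it. -/
def span (S : Set L) : TwoLieIdeal L where
  toLieSubmodule := sInf {J | S ⊆ (J : Set L) ∧ ∀ x ∈ J, TwoLieAlgebra.sq x ∈ J}
  sq_mem := by
    intro x hx
    have hx' : ∀ J ∈ {J : LieIdeal (ZMod 2) L | S ⊆ (J : Set L) ∧ ∀ x ∈ J, TwoLieAlgebra.sq x ∈ J},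
        x ∈ J := fun J hJ => (sInf_le hJ : _ ≤ J) hx
    rw [← SetLike.mem_coe, LieSubmodule.coe_sInf, Set.mem_iInter₂]
    exact fun J hJ => hJ.2 x (hx' J hJ)

variable (I : TwoLieIdeal L)

instance : LieRing I.Quot := inferInstanceAs (LieRing (L ⧸ I.toLieSubmodule))

instance : LieAlgebra (ZMod 2) I.Quot :=
  inferInstanceAs (LieAlgebra (ZMod 2) (L ⧸ I.toLieSubmodule))

/-- The quotient map. -/
def proj : L →ₗ⁅ZMod 2⁆ I.Quot where
  toFun x := (LieSubmodule.Quotient.mk x : L ⧸ I.toLieSubmodule)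
  map_add' _ _ := rfl
  map_smul' _ _ := rfl
  map_lie' := rfl

theorem proj_surjective : Function.Surjective I.proj := Quot.mk_surjective

theorem proj_eq_zero (x : L) : I.proj x = 0 ↔ x ∈ I.toLieSubmodule :=
  LieSubmodule.Quotient.mk_eq_zero' (N := I.toLieSubmodule)

theorem proj_sq_congr {x y : L} (hz : y - x ∈ I.toLieSubmodule) :
    I.proj (TwoLieAlgebra.sq x) = I.proj (TwoLieAlgebra.sq y) := by
  have h1 : I.proj (TwoLieAlgebra.sq (y - x)) = 0 := (I.proj_eq_zero _).2 (I.sq_mem _ hz)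
  have h2 : I.proj ⁅x, y - x⁆ = 0 := (I.proj_eq_zero _).2 (lie_mem_right (ZMod 2) L _ _ _ hz)
  have h3 := TwoLieAlgebra.sq_add x (y - x)
  rw [add_sub_cancel] at h3
  rw [h3, map_add, map_add, h1, h2, add_zero, add_zero]

/-- The 2-power operation induced on the quotient. -/
def quotSq : I.Quot → I.Quot :=
  Quot.lift (fun x => I.proj (TwoLieAlgebra.sq x)) fun x y h => I.proj_sq_congr (by
    have h1 : -x + y ∈ I.toLieSubmodule := QuotientAddGroup.leftRel_apply.1 h
    rwa [neg_add_eq_sub] at h1)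

theorem quotSq_proj (x : L) : I.quotSq (I.proj x) = I.proj (TwoLieAlgebra.sq x) := rfl

instance : TwoLieAlgebra I.Quot where
  sq := I.quotSq
  lie_sq x y := by
    obtain ⟨x, rfl⟩ := I.proj_surjective x
    obtain ⟨y, rfl⟩ := I.proj_surjective y
    rw [quotSq_proj, ← LieHom.map_lie, TwoLieAlgebra.lie_sq, LieHom.map_lie, LieHom.map_lie]
  sq_smul a x := by
    obtain ⟨x, rfl⟩ := I.proj_surjective x
    rw [quotSq_proj, ← map_smul, quotSq_proj, TwoLieAlgebra.sq_smul, map_smul]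
  sq_add x y := by
    obtain ⟨x, rfl⟩ := I.proj_surjective x
    obtain ⟨y, rfl⟩ := I.proj_surjective y
    rw [← map_add, quotSq_proj, quotSq_proj, quotSq_proj, ← LieHom.map_lie, TwoLieAlgebra.sq_add,
      map_add, map_add]

theorem proj_sq (x : L) : I.proj (TwoLieAlgebra.sq x) = TwoLieAlgebra.sq (I.proj x) := rfl

end

end TwoLieIdeal

/-! ### Free 2-Lie algebras -/

/-- Formal expressions in the operations of a 2-Lie algebra over `ZMod 2`. Negatives and scalar
multiples are not needed, since the ground field has two elements. -/
inductive TwoLieTerm (X : Type*) : Type _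
  | of (x : X) : TwoLieTerm X
  | zero : TwoLieTerm X
  | add (a b : TwoLieTerm X) : TwoLieTerm X
  | lie (a b : TwoLieTerm X) : TwoLieTerm X
  | sq (a : TwoLieTerm X) : TwoLieTerm X

/-- The congruence on formal expressions generated by the axioms of 2-Lie algebras. -/
inductive TwoLieTerm.Rel {X : Type*} : TwoLieTerm X → TwoLieTerm X → Prop
  | refl (a) : Rel a a
  | symm {a b} : Rel a b → Rel b a
  | trans {a b c} : Rel a b → Rel b c → Rel a c
  | add_congr {a a' b b'} : Rel a a' → Rel b b' → Rel (add a b) (add a' b')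
  | lie_congr {a a' b b'} : Rel a a' → Rel b b' → Rel (lie a b) (lie a' b')
  | sq_congr {a a'} : Rel a a' → Rel (sq a) (sq a')
  | add_assoc (a b c) : Rel (add (add a b) c) (add a (add b c))
  | add_comm (a b) : Rel (add a b) (add b a)
  | zero_add (a) : Rel (add zero a) a
  | add_self (a) : Rel (add a a) zero
  | add_lie (a b c) : Rel (lie (add a b) c) (add (lie a c) (lie b c))
  | lie_add (a b c) : Rel (lie a (add b c)) (add (lie a b) (lie a c))
  | lie_self (a) : Rel (lie a a) zero
  | leibniz (a b c) : Rel (lie a (lie b c)) (add (lie (lie a b) c) (lie b (lie a c)))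
  | lie_sq (a b) : Rel (lie a (sq b)) (lie (lie a b) b)
  | sq_add (a b) : Rel (sq (add a b)) (add (add (sq a) (sq b)) (lie a b))

/-- The free 2-Lie algebra over `ZMod 2` generated by `X`. -/
def FreeTwoLie (X : Type*) : Type _ :=
  Quot (TwoLieTerm.Rel (X := X))

namespace FreeTwoLie

open TwoLieTerm (Rel)

section

variable {X : Type*}

/-- The element represented by a formal expression. -/
def mk (a : TwoLieTerm X) : FreeTwoLie X := Quot.mk _ a

/-- The free generators. -/
def of (x : X) : FreeTwoLie X := mk (.of x)

instance : Zero (FreeTwoLie X) := ⟨Quot.mk _ .zero⟩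

instance : Add (FreeTwoLie X) :=
  ⟨Quot.map₂ .add (fun _ _ _ h => .add_congr (.refl _) h) (fun _ _ _ h => .add_congr h (.refl _))⟩

instance : Neg (FreeTwoLie X) := ⟨fun a => a⟩

instance : AddCommGroup (FreeTwoLie X) where
  add_assoc := by rintro ⟨a⟩ ⟨b⟩ ⟨c⟩; exact Quot.sound (.add_assoc a b c)
  zero_add := by rintro ⟨a⟩; exact Quot.sound (.zero_add a)
  add_zero := by rintro ⟨a⟩; exact Quot.sound (.trans (.add_comm _ _) (.zero_add a))
  neg_add_cancel := by rintro ⟨a⟩; exact Quot.sound (.add_self a)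
  add_comm := by rintro ⟨a⟩ ⟨b⟩; exact Quot.sound (.add_comm a b)
  nsmul := nsmulRec
  zsmul := zsmulRec

theorem add_self_eq_zero (a : FreeTwoLie X) : a + a = 0 := by
  rcases a with ⟨a⟩
  exact Quot.sound (.add_self a)

instance : LieRing (FreeTwoLie X) where
  bracket := Quot.map₂ .lie (fun _ _ _ h => .lie_congr (.refl _) h)
    (fun _ _ _ h => .lie_congr h (.refl _))
  add_lie := by rintro ⟨a⟩ ⟨b⟩ ⟨c⟩; exact Quot.sound (.add_lie a b c)
  lie_add := by rintro ⟨a⟩ ⟨b⟩ ⟨c⟩; exact Quot.sound (.lie_add a b c)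
  lie_self := by rintro ⟨a⟩; exact Quot.sound (.lie_self a)
  leibniz_lie := by rintro ⟨a⟩ ⟨b⟩ ⟨c⟩; exact Quot.sound (.leibniz a b c)

instance : Module (ZMod 2) (FreeTwoLie X) :=
  AddCommGroup.zmodModule (n := 2) fun a => by rw [two_nsmul, add_self_eq_zero]

instance : LieAlgebra (ZMod 2) (FreeTwoLie X) where
  lie_smul c x y := by
    obtain rfl | rfl : c = 0 ∨ c = 1 := by revert c; decide
    · simp
    · simp

theorem sq_aux (s : FreeTwoLie X → FreeTwoLie X)
    (h : ∀ x y, s (x + y) = s x + s y + ⁅x, y⁆) (c : ZMod 2) (x : FreeTwoLie X) :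
    s (c • x) = c ^ 2 • s x := by
  obtain rfl | rfl : c = 0 ∨ c = 1 := by revert c; decide
  · have h0 := h 0 0
    rw [add_zero, lie_self, add_zero, add_self_eq_zero] at h0
    simp [h0]
  · simp

instance : TwoLieAlgebra (FreeTwoLie X) where
  sq := Quot.map .sq (fun _ _ h => .sq_congr h)
  lie_sq := by rintro ⟨a⟩ ⟨b⟩; exact Quot.sound (.lie_sq a b)
  sq_smul := by
    apply sq_aux
    rintro ⟨a⟩ ⟨b⟩; exact Quot.sound (.sq_add a b)
  sq_add := by rintro ⟨a⟩ ⟨b⟩; exact Quot.sound (.sq_add a b)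

variable {L : Type*} [LieRing L] [LieAlgebra (ZMod 2) L] [TwoLieAlgebra L]

/-- Evaluation of formal expressions in a 2-Lie algebra. -/
def eval (f : X → L) : TwoLieTerm X → L
  | .of x => f x
  | .zero => 0
  | .add a b => eval f a + eval f b
  | .lie a b => ⁅eval f a, eval f b⁆
  | .sq a => TwoLieAlgebra.sq (eval f a)

theorem eval_rel (f : X → L) {a b : TwoLieTerm X} (h : Rel a b) : eval f a = eval f b := by
  induction h with
  | refl => rfl
  | symm _ ih => exact ih.symm
  | trans _ _ ih1 ih2 => exact ih1.trans ih2
  | add_congr _ _ ih1 ih2 => simp only [eval, ih1, ih2]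
  | lie_congr _ _ ih1 ih2 => simp only [eval, ih1, ih2]
  | sq_congr _ ih => simp only [eval, ih]
  | add_assoc => simp only [eval, add_assoc]
  | add_comm => simp only [eval, add_comm]
  | zero_add => simp only [eval, zero_add]
  | add_self a =>
    simp only [eval]
    rw [← two_smul (ZMod 2) (eval f a), show (2 : ZMod 2) = 0 from rfl, zero_smul]
  | add_lie => simp only [eval, add_lie]
  | lie_add => simp only [eval, lie_add]
  | lie_self => simp only [eval, lie_self]
  | leibniz => simp only [eval]; exact leibniz_lie _ _ _
  | lie_sq => simp only [eval, TwoLieAlgebra.lie_sq]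
  | sq_add => simp only [eval, TwoLieAlgebra.sq_add]

/-- The map to a 2-Lie algebra extending a given map on the generators. -/
def liftFun (f : X → L) : FreeTwoLie X → L := Quot.lift (eval f) fun _ _ h => eval_rel f h

/-- The homomorphism to a 2-Lie algebra extending a given map on the generators. -/
def lift (f : X → L) : FreeTwoLie X →ₗ⁅ZMod 2⁆ L :=
  { AddMonoidHom.toZModLinearMap 2
      (AddMonoidHom.mk' (liftFun f) (by rintro ⟨a⟩ ⟨b⟩; rfl)) with
    map_lie' := by rintro ⟨a⟩ ⟨b⟩; rfl }

/-- The universal property of the free 2-Lie algebra. -/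
theorem existsUnique_lift (f : X → L) :
    ∃! φ : FreeTwoLie X →ₗ⁅ZMod 2⁆ L,
      (∀ x, φ (TwoLieAlgebra.sq x) = TwoLieAlgebra.sq (φ x)) ∧ ∀ i, φ (of i) = f i := by
  refine ⟨lift f, ⟨by rintro ⟨a⟩; rfl, fun i => rfl⟩, ?_⟩
  rintro φ ⟨h1, h2⟩
  ext ⟨a⟩
  induction a with
  | of x => exact h2 x
  | zero => exact (map_zero φ).trans (map_zero (lift f)).symm
  | add a b iha ihb =>
    exact (map_add φ (mk a) (mk b)).trans (congrArg₂ (· + ·) iha ihb)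
  | lie a b iha ihb =>
    exact (LieHom.map_lie φ (mk a) (mk b)).trans
      (congrArg₂ (fun u v => ⁅u, v⁆) iha ihb)
  | sq a iha => exact (h1 (mk a)).trans (congrArg TwoLieAlgebra.sq iha)

end

end FreeTwoLie

/-! ### 2-central series and their associated 2-Lie algebras -/

/-- A (descending) 2-central series on a group, with group commutator `(g, h) = g⁻¹h⁻¹gh`. -/
structure TwoCentralSeries (G : Type*) [Group G] where
  /-- the `k`-th term, `k ≥ 1` -/
  term : ℕ+ → Subgroup G
  term_one : term 1 = ⊤
  term_succ_le : ∀ k, term (k + 1) ≤ term k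
  comm_mem : ∀ {k l : ℕ+} {g h : G}, g ∈ term k → h ∈ term l → g⁻¹ * h⁻¹ * g * h ∈ term (k + l)
  pow_two_mem : ∀ {k : ℕ+} {g : G}, g ∈ term k → g ^ 2 ∈ term (2 * k)

/-- The lower 2-central series: the fastest descending 2-central series, that is, the one contained
termwise in every other. -/
def lowerTwoCentralSeries (G : Type*) [Group G] : TwoCentralSeries G where
  term k := ⨅ Γ : TwoCentralSeries G, Γ.term k
  term_one := by simp [TwoCentralSeries.term_one]
  term_succ_le k := iInf_mono fun Γ => Γ.term_succ_le k
  comm_mem hg hh := by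
    rw [Subgroup.mem_iInf] at *
    exact fun Γ => Γ.comm_mem (hg Γ) (hh Γ)
  pow_two_mem hg := by
    rw [Subgroup.mem_iInf] at *
    exact fun Γ => Γ.pow_two_mem (hg Γ)

theorem lowerTwoCentralSeries_le {G : Type*} [Group G] (Γ : TwoCentralSeries G) (k : ℕ+) :
    (lowerTwoCentralSeries G).term k ≤ Γ.term k :=
  iInf_le _ Γ

namespace TwoCentralSeries

theorem pnat_two_mul (k : ℕ+) : 2 * k = k + k := PNat.eq (two_mul (k : ℕ))

section

variable {G : Type*} [Group G] (Γ : TwoCentralSeries G)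

theorem term_anti {k l : ℕ+} (h : k ≤ l) : Γ.term l ≤ Γ.term k := by
  induction l using PNat.recOn with
  | one => rw [le_one_iff_eq_one.1 h]
  | succ n ih =>
    rcases h.eq_or_lt with rfl | h
    · exact le_rfl
    · exact (Γ.term_succ_le n).trans (ih (PNat.lt_add_one_iff.1 h))

instance term_normal (k : ℕ+) : (Γ.term k).Normal where
  conj_mem h hh g := by
    have hg : g⁻¹ ∈ Γ.term 1 := by rw [Γ.term_one]; trivial
    have h1 := Γ.term_succ_le _ (Γ.comm_mem hh hg)
    have h2 := (Γ.term k).mul_mem hh h1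
    convert h2 using 1
    group

/-- Elements of the `k`-th term are central modulo the next one. -/
theorem mk_commute {k : ℕ+} {c : G} (hc : c ∈ Γ.term k) (g : G) :
    Commute (c : G ⧸ Γ.term (k + 1)) (g : G ⧸ Γ.term (k + 1)) := by
  have hg : g ∈ Γ.term 1 := by rw [Γ.term_one]; trivial
  have h := (QuotientGroup.eq_one_iff _).2 (Γ.comm_mem hc hg)
  have h2 : ((c : G ⧸ Γ.term (k + 1)))⁻¹ * (g : G ⧸ Γ.term (k + 1))⁻¹ * c * g = 1 := by
    exact_mod_cast h
  show _ * _ = _ * _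
  calc (c : G ⧸ Γ.term (k + 1)) * g
      = g * c * ((c : G ⧸ Γ.term (k + 1))⁻¹ * (g : G ⧸ Γ.term (k + 1))⁻¹ * c * g) := by group
    _ = _ := by rw [h2, mul_one]

/-- The graded component `Γ_k / Γ_{k+1}`, written additively. -/
def Gr (k : ℕ+) : Type _ :=
  Additive (Γ.term k ⧸ (Γ.term (k + 1)).subgroupOf (Γ.term k))

/-- The class of an element of `Γ_k` in `Γ_k / Γ_{k+1}`. -/
def cls (k : ℕ+) (g : Γ.term k) : Γ.Gr k :=
  Additive.ofMul (QuotientGroup.mk g)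

theorem cls_eq_iff {k : ℕ+} {a b : Γ.term k} :
    Γ.cls k a = Γ.cls k b ↔ ((a : G) : G ⧸ Γ.term (k + 1)) = ((b : G) : G ⧸ Γ.term (k + 1)) :=
  Iff.trans (QuotientGroup.eq (s := (Γ.term (k + 1)).subgroupOf (Γ.term k)))
    (Iff.trans Iff.rfl (QuotientGroup.eq (s := Γ.term (k + 1)) (a := (a : G)) (b := b)).symm)

theorem cls_surjective (k : ℕ+) : Function.Surjective (Γ.cls k) := QuotientGroup.mk_surjective

instance (k : ℕ+) : AddGroup (Γ.Gr k) :=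
  inferInstanceAs (AddGroup (Additive (Γ.term k ⧸ (Γ.term (k + 1)).subgroupOf (Γ.term k))))

theorem cls_mul {k : ℕ+} (a b : Γ.term k) : Γ.cls k (a * b) = Γ.cls k a + Γ.cls k b := rfl

theorem cls_one (k : ℕ+) : Γ.cls k 1 = 0 := rfl

theorem cls_inv {k : ℕ+} (a : Γ.term k) : Γ.cls k a⁻¹ = - Γ.cls k a := rfl

instance (k : ℕ+) : AddCommGroup (Γ.Gr k) where
  add_comm x y := by
    obtain ⟨a, rfl⟩ := Γ.cls_surjective k x
    obtain ⟨b, rfl⟩ := Γ.cls_surjective k y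
    rw [← cls_mul, ← cls_mul, cls_eq_iff]
    exact Γ.mk_commute a.2 b

theorem two_nsmul_eq_zero (k : ℕ+) (x : Γ.Gr k) : 2 • x = 0 := by
  obtain ⟨a, rfl⟩ := Γ.cls_surjective k x
  rw [two_nsmul, ← cls_mul, ← cls_one, cls_eq_iff]
  refine (QuotientGroup.eq_one_iff _).2 ?_
  have h := Γ.pow_two_mem a.2
  rw [pow_two] at h
  refine Γ.term_anti ?_ h
  rw [pnat_two_mul]
  exact add_le_add_right (one_le : 1 ≤ k) k

instance (k : ℕ+) : Module (ZMod 2) (Γ.Gr k) :=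
  AddCommGroup.zmodModule (n := 2) (Γ.two_nsmul_eq_zero k)

theorem mk_comm_mul_left {k l : ℕ+} {a b h : G} (ha : a ∈ Γ.term k) (hh : h ∈ Γ.term l) :
    (((a * b)⁻¹ * h⁻¹ * (a * b) * h : G) : G ⧸ Γ.term (k + l + 1)) =
      ((a⁻¹ * h⁻¹ * a * h * (b⁻¹ * h⁻¹ * b * h) : G) : G ⧸ Γ.term (k + l + 1)) := by
  have h1 := Γ.mk_commute (Γ.comm_mem ha hh) b
  have e : (a * b)⁻¹ * h⁻¹ * (a * b) * h =
      b⁻¹ * ((a⁻¹ * h⁻¹ * a * h) * b) * (b⁻¹ * h⁻¹ * b * h) := by group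
  rw [e, QuotientGroup.mk_mul, QuotientGroup.mk_mul, QuotientGroup.mk_mul, h1.eq,
    QuotientGroup.mk_mul _ (a⁻¹ * h⁻¹ * a * h), QuotientGroup.mk_inv, inv_mul_cancel_left]

theorem mk_comm_mul_right {k l : ℕ+} {g a b : G} (hg : g ∈ Γ.term k) (ha : a ∈ Γ.term l) :
    ((g⁻¹ * (a * b)⁻¹ * g * (a * b) : G) : G ⧸ Γ.term (k + l + 1)) =
      ((g⁻¹ * a⁻¹ * g * a * (g⁻¹ * b⁻¹ * g * b) : G) : G ⧸ Γ.term (k + l + 1)) := by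
  have h1 := Γ.mk_commute (Γ.comm_mem hg ha)
  have e : g⁻¹ * (a * b)⁻¹ * g * (a * b) =
      (g⁻¹ * b⁻¹ * g * b) * (b⁻¹ * ((g⁻¹ * a⁻¹ * g * a) * b)) := by group
  generalize g⁻¹ * a⁻¹ * g * a = c at h1 e
  generalize g⁻¹ * b⁻¹ * g * b = d at e
  rw [e, QuotientGroup.mk_mul, QuotientGroup.mk_mul, QuotientGroup.mk_mul, (h1 b).eq,
    QuotientGroup.mk_inv, inv_mul_cancel_left, QuotientGroup.mk_mul, (h1 d).eq]

/-- The bracket `[ḡ, h̄] = class of (g, h)` on homogeneous classes. -/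
def brkFun (k l : ℕ+) : Γ.Gr k → Γ.Gr l → Γ.Gr (k + l) :=
  Quotient.map₂ (fun g h => ⟨(g : G)⁻¹ * (h : G)⁻¹ * g * h, Γ.comm_mem g.2 h.2⟩) (by
    intro a a' ha b b' hb
    refine QuotientGroup.leftRel_apply.2 (QuotientGroup.eq.1 (Γ.cls_eq_iff.2 ?_))
    have hz : (a : G)⁻¹ * a' ∈ Γ.term (k + 1) := by
      have h := QuotientGroup.leftRel_apply.1 (show QuotientGroup.leftRel _ a a' from ha)
      exact h
    have hw : (b : G)⁻¹ * b' ∈ Γ.term (l + 1) := by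
      have h := QuotientGroup.leftRel_apply.1 (show QuotientGroup.leftRel _ b b' from hb)
      exact h
    have e1 := Γ.mk_comm_mul_left (b := (a : G)⁻¹ * a') a.2 b'.2
    have e2 := Γ.mk_comm_mul_right (b := (b : G)⁻¹ * b') a.2 b.2
    have f1 := Γ.comm_mem hz b'.2
    have f2 := Γ.comm_mem a.2 hw
    rw [add_right_comm] at f1
    rw [← add_assoc] at f2
    rw [mul_inv_cancel_left, QuotientGroup.mk_mul _ (_ * _ * _ * (b' : G)),
      (QuotientGroup.eq_one_iff _).2 f1, mul_one] at e1
    rw [mul_inv_cancel_left, QuotientGroup.mk_mul _ (_ * _ * _ * (b : G)),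
      (QuotientGroup.eq_one_iff _).2 f2, mul_one] at e2
    exact (e1.trans e2).symm)

theorem brkFun_cls {k l : ℕ+} (g : Γ.term k) (h : Γ.term l) :
    Γ.brkFun k l (Γ.cls k g) (Γ.cls l h) =
      Γ.cls (k + l) ⟨(g : G)⁻¹ * (h : G)⁻¹ * g * h, Γ.comm_mem g.2 h.2⟩ := rfl

/-- The bracket of homogeneous classes as a biadditive map. -/
def brk (k l : ℕ+) : Γ.Gr k →+ Γ.Gr l →+ Γ.Gr (k + l) :=
  AddMonoidHom.mk' (fun x => AddMonoidHom.mk' (Γ.brkFun k l x) (by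
      intro y z
      obtain ⟨g, rfl⟩ := Γ.cls_surjective k x
      obtain ⟨a, rfl⟩ := Γ.cls_surjective l y
      obtain ⟨b, rfl⟩ := Γ.cls_surjective l z
      rw [← cls_mul, brkFun_cls, brkFun_cls, brkFun_cls, ← cls_mul, cls_eq_iff]
      exact Γ.mk_comm_mul_right g.2 a.2)) (by
    intro y z
    ext x
    obtain ⟨g, rfl⟩ := Γ.cls_surjective l x
    obtain ⟨a, rfl⟩ := Γ.cls_surjective k y
    obtain ⟨b, rfl⟩ := Γ.cls_surjective k z
    simp only [AddMonoidHom.mk'_apply, AddMonoidHom.add_apply]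
    rw [← cls_mul, brkFun_cls, brkFun_cls, brkFun_cls, ← cls_mul, cls_eq_iff]
    exact Γ.mk_comm_mul_left a.2 g.2)

theorem brk_cls {k l : ℕ+} (g : Γ.term k) (h : Γ.term l) :
    Γ.brk k l (Γ.cls k g) (Γ.cls l h) =
      Γ.cls (k + l) ⟨(g : G)⁻¹ * (h : G)⁻¹ * g * h, Γ.comm_mem g.2 h.2⟩ := rfl

/-- The 2-power `ḡ ↦ class of g²` on homogeneous classes. -/
def sqFun (k : ℕ+) : Γ.Gr k → Γ.Gr (2 * k) :=
  Quotient.map (fun g => ⟨(g : G) ^ 2, Γ.pow_two_mem g.2⟩) (by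
    intro a a' ha
    refine QuotientGroup.leftRel_apply.2 (QuotientGroup.eq.1 (Γ.cls_eq_iff.2 ?_))
    have hz : (a : G)⁻¹ * a' ∈ Γ.term (k + 1) := by
      have h := QuotientGroup.leftRel_apply.1 (show QuotientGroup.leftRel _ a a' from ha)
      exact h
    generalize hz' : (a : G)⁻¹ * a' = z at hz
    have hza : (a' : G) = a * z := by rw [← hz', mul_inv_cancel_left]
    have f1 := Γ.comm_mem a.2 ((Γ.term (k + 1)).inv_mem hz)
    have f2 := Γ.pow_two_mem hz
    have i1 : 2 * k + 1 ≤ k + (k + 1) := by rw [pnat_two_mul, add_assoc]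
    have i2 : 2 * k + 1 ≤ 2 * (k + 1) := by
      rw [pnat_two_mul, pnat_two_mul, add_add_add_comm]
      exact add_le_add_right (one_le : 1 ≤ (_ : ℕ+)) _
    have g1 := (QuotientGroup.eq_one_iff _).2 (Γ.term_anti i1 f1)
    have g2 := (QuotientGroup.eq_one_iff _).2 (Γ.term_anti i2 f2)
    have e : (a' : G) ^ 2 = (a : G) ^ 2 * ((a : G)⁻¹ * z⁻¹⁻¹ * a * z⁻¹) * z ^ 2 := by
      rw [hza]; simp [pow_two, mul_assoc]
    simp only
    rw [e, QuotientGroup.mk_mul, QuotientGroup.mk_mul, g1, g2, mul_one, mul_one])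

theorem sqFun_cls {k : ℕ+} (g : Γ.term k) :
    Γ.sqFun k (Γ.cls k g) = Γ.cls (2 * k) ⟨(g : G) ^ 2, Γ.pow_two_mem g.2⟩ := rfl

/-- The associated graded `gr Γ = ⨁_{k ≥ 1} Γ_k / Γ_{k+1}`. -/
def GrSum : Type _ := ⨁ k : ℕ+, Γ.Gr k

noncomputable instance : AddCommGroup Γ.GrSum := inferInstanceAs (AddCommGroup (⨁ k : ℕ+, Γ.Gr k))

noncomputable instance : Module (ZMod 2) Γ.GrSum :=
  inferInstanceAs (Module (ZMod 2) (⨁ k : ℕ+, Γ.Gr k))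

/-- The inclusion of a graded component. -/
noncomputable def incl (k : ℕ+) : Γ.Gr k →+ Γ.GrSum := DirectSum.of (fun k => Γ.Gr k) k

theorem induction_on {motive : Γ.GrSum → Prop} (x : Γ.GrSum) (zero : motive 0)
    (incl : ∀ (k : ℕ+) (g : Γ.term k), motive (Γ.incl k (Γ.cls k g)))
    (add : ∀ x y, motive x → motive y → motive (x + y)) : motive x := by
  refine DirectSum.induction_on x zero (fun k y => ?_) add
  obtain ⟨g, rfl⟩ := Γ.cls_surjective k y
  exact incl k g

theorem incl_cls_congr {k l : ℕ+} (h : k = l) (a : Γ.term k) (b : Γ.term l)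
    (hab : (a : G) = b) : Γ.incl k (Γ.cls k a) = Γ.incl l (Γ.cls l b) := by
  subst h
  congr 2
  exact Subtype.ext hab

theorem incl_cls_conj {k : ℕ+} (g : G) (a b : Γ.term k)
    (hab : (b : G) = g⁻¹ * a * g) : Γ.cls k b = Γ.cls k a := by
  rw [cls_eq_iff, hab, mul_assoc, QuotientGroup.mk_mul, QuotientGroup.mk_mul,
    (Γ.mk_commute a.2 g).eq, QuotientGroup.mk_inv, inv_mul_cancel_left]

/-- The bracket on `gr Γ`, extended biadditively from homogeneous classes. -/
noncomputable def brkHom : Γ.GrSum →+ Γ.GrSum →+ Γ.GrSum :=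
  DirectSum.toAddMonoid fun k => AddMonoidHom.flip (DirectSum.toAddMonoid fun l =>
    AddMonoidHom.flip ((AddMonoidHom.compHom (Γ.incl (k + l))).comp (Γ.brk k l)))

theorem brkHom_incl {k l : ℕ+} (x : Γ.Gr k) (y : Γ.Gr l) :
    Γ.brkHom (Γ.incl k x) (Γ.incl l y) = Γ.incl (k + l) (Γ.brk k l x y) := by
  exact (DFunLike.congr_fun (DirectSum.toAddMonoid_of (β := Γ.Gr) _ k x) (Γ.incl l y)).trans
    (DirectSum.toAddMonoid_of (β := Γ.Gr)
      (fun l => ((AddMonoidHom.compHom (Γ.incl (k + l))).comp (Γ.brk k l)) x) l y)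

theorem brkHom_skew (x y : Γ.GrSum) : Γ.brkHom x y + Γ.brkHom y x = 0 := by
  induction x using Γ.induction_on with
  | zero => simp
  | add x x' h h' =>
    rw [map_add, map_add, AddMonoidHom.add_apply, add_add_add_comm, h, h', add_zero]
  | incl k g =>
    induction y using Γ.induction_on with
    | zero => simp
    | add y y' h h' =>
      rw [map_add, map_add, AddMonoidHom.add_apply, add_add_add_comm, h, h', add_zero]
    | incl l w =>
      rw [brkHom_incl, brkHom_incl, brk_cls, brk_cls]
      rw [Γ.incl_cls_congr (add_comm l k) _
        ⟨((g : G)⁻¹ * (w : G)⁻¹ * g * w)⁻¹, inv_mem (Γ.comm_mem g.2 w.2)⟩ (by simp [mul_assoc]),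
        ← map_add, ← cls_mul]
      convert map_zero (Γ.incl (k + l))
      rw [← cls_one]
      congr 1
      exact Subtype.ext (mul_inv_cancel _)

theorem brkHom_self (x : Γ.GrSum) : Γ.brkHom x x = 0 := by
  induction x using Γ.induction_on with
  | zero => simp
  | add x y hx hy =>
    rw [map_add, map_add, AddMonoidHom.add_apply, AddMonoidHom.add_apply, hx, hy, zero_add,
      add_zero, add_comm, brkHom_skew]
  | incl k g =>
    rw [brkHom_incl, brk_cls]
    convert map_zero (Γ.incl (k + k))
    rw [← cls_one]
    congr 1
    exact Subtype.ext (by simp)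

/-- The Jacobi identity on homogeneous classes, from the Hall–Witt identity. -/
theorem brkHom_jacobi_incl {k l m : ℕ+} (x : Γ.term k) (y : Γ.term l) (z : Γ.term m) :
    Γ.brkHom (Γ.brkHom (Γ.incl k (Γ.cls k x)) (Γ.incl l (Γ.cls l y))) (Γ.incl m (Γ.cls m z)) +
    Γ.brkHom (Γ.brkHom (Γ.incl l (Γ.cls l y)) (Γ.incl m (Γ.cls m z))) (Γ.incl k (Γ.cls k x)) +
    Γ.brkHom (Γ.brkHom (Γ.incl m (Γ.cls m z)) (Γ.incl k (Γ.cls k x))) (Γ.incl l (Γ.cls l y)) =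
      0 := by
  have key : ∀ {k l m : ℕ+} (x : Γ.term k) (y : Γ.term l) (z : Γ.term m) (n : ℕ+)
      (hn : n = k + l + m),
      ∃ h : (y : G)⁻¹ * (((x : G)⁻¹ * (y⁻¹ : G)⁻¹ * x * (y⁻¹ : G))⁻¹ * (z : G)⁻¹ *
        ((x : G)⁻¹ * (y⁻¹ : G)⁻¹ * x * (y⁻¹ : G)) * z) * y ∈ Γ.term n,
      Γ.brkHom (Γ.brkHom (Γ.incl k (Γ.cls k x)) (Γ.incl l (Γ.cls l y))) (Γ.incl m (Γ.cls m z)) =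
      - Γ.incl n (Γ.cls n ⟨_, h⟩) := by
    intro k l m x y z n hn
    subst hn
    have h0 := Γ.comm_mem (Γ.comm_mem x.2 (y⁻¹).2) z.2
    refine ⟨by simpa using (Γ.term_normal _).conj_mem _ h0 (y : G)⁻¹, ?_⟩
    rw [Γ.incl_cls_conj (y : G) ⟨_, h0⟩ _ rfl]
    have e : Γ.incl l (Γ.cls l y) = - Γ.incl l (Γ.cls l y⁻¹) := by
      rw [cls_inv, map_neg, neg_neg]
    rw [e, map_neg, map_neg, AddMonoidHom.neg_apply, brkHom_incl, brkHom_incl]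
    rfl
  obtain ⟨h1, e1⟩ := key x y z (k + l + m) rfl
  obtain ⟨h2, e2⟩ := key y z x (k + l + m) (by rw [add_assoc, add_comm])
  obtain ⟨h3, e3⟩ := key z x y (k + l + m) (by rw [add_comm, add_assoc])
  rw [e1, e2, e3, ← neg_add, ← neg_add, neg_eq_zero, ← map_add, ← map_add, ← cls_mul, ← cls_mul]
  convert map_zero (Γ.incl (k + l + m))
  rw [← cls_one]
  congr 1
  apply Subtype.ext
  simp only [Subgroup.coe_mul, Subgroup.coe_one]
  group

theorem brkHom_jacobi (x y z : Γ.GrSum) :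
    Γ.brkHom (Γ.brkHom x y) z + Γ.brkHom (Γ.brkHom y z) x + Γ.brkHom (Γ.brkHom z x) y = 0 := by
  induction x using Γ.induction_on with
  | zero => simp
  | add x x' h h' =>
    have := congrArg₂ (· + ·) h h'
    simp only [map_add, AddMonoidHom.add_apply, add_zero] at this ⊢
    rw [← this]; abel
  | incl k a =>
    induction y using Γ.induction_on with
    | zero => simp
    | add x x' h h' =>
      have := congrArg₂ (· + ·) h h'
      simp only [map_add, AddMonoidHom.add_apply, add_zero] at this ⊢
      rw [← this]; abel
    | incl l b =>
      induction z using Γ.induction_on with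
      | zero => simp
      | add x x' h h' =>
        have := congrArg₂ (· + ·) h h'
        simp only [map_add, AddMonoidHom.add_apply, add_zero] at this ⊢
        rw [← this]; abel
      | incl m c => exact Γ.brkHom_jacobi_incl a b c

noncomputable instance : LieRing Γ.GrSum where
  bracket x y := Γ.brkHom x y
  add_lie x y z := by simp
  lie_add x y z := by simp
  lie_self x := Γ.brkHom_self x
  leibniz_lie x y z := by
    show Γ.brkHom x (Γ.brkHom y z) = Γ.brkHom (Γ.brkHom x y) z + Γ.brkHom y (Γ.brkHom x z)
    have h := Γ.brkHom_jacobi x y z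
    have h1 := eq_neg_of_add_eq_zero_left (Γ.brkHom_skew x (Γ.brkHom y z))
    have h2 := eq_neg_of_add_eq_zero_left (Γ.brkHom_skew y (Γ.brkHom x z))
    have h3 := eq_neg_of_add_eq_zero_left (Γ.brkHom_skew x z)
    rw [h1, h2, h3, map_neg, AddMonoidHom.neg_apply, neg_neg]
    rw [neg_eq_iff_add_eq_zero, ← h]
    abel

noncomputable instance : LieAlgebra (ZMod 2) Γ.GrSum where
  lie_smul c x y := by
    obtain rfl | rfl : c = 0 ∨ c = 1 := by revert c; decide
    · simp
    · simp

theorem lie_incl {k l : ℕ+} (x : Γ.Gr k) (y : Γ.Gr l) :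
    ⁅Γ.incl k x, Γ.incl l y⁆ = Γ.incl (k + l) (Γ.brk k l x y) :=
  Γ.brkHom_incl x y

theorem add_self_eq_zero (x : Γ.GrSum) : x + x = 0 := by
  rw [← two_smul (ZMod 2) x, show (2 : ZMod 2) = 0 from rfl, zero_smul]

theorem lie_comm (x y : Γ.GrSum) : ⁅x, y⁆ = ⁅y, x⁆ := by
  rw [← lie_skew, neg_eq_iff_add_eq_zero, add_self_eq_zero]

/-- The homogeneous component of degree `k` of an element, as an element of `gr Γ`. -/
noncomputable def comp (x : Γ.GrSum) (k : ℕ+) : Γ.GrSum :=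
  Γ.incl k ((show ⨁ k : ℕ+, Γ.Gr k from x) k)

/-- The 2-power of the homogeneous component of degree `k` of an element. -/
noncomputable def compSq (x : Γ.GrSum) (k : ℕ+) : Γ.GrSum :=
  Γ.incl (2 * k) (Γ.sqFun k ((show ⨁ k : ℕ+, Γ.Gr k from x) k))

open Classical in
/-- The degrees in which an element has a nonzero component. -/
noncomputable def degs (x : Γ.GrSum) : Finset ℕ+ :=
  DFinsupp.support (show Π₀ k : ℕ+, Γ.Gr k from x)

/-- The 2-power operation on `gr Γ`: the only extension of the 2-power of homogeneous classes
satisfying `(x + y)^[2] = x^[2] + y^[2] + [x, y]`, namely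
`(∑ x_k)^[2] = ∑ x_k^[2] + ∑_{k < l} [x_k, x_l]`. -/
noncomputable def sqTot (x : Γ.GrSum) : Γ.GrSum :=
  ∑ k ∈ Γ.degs x, Γ.compSq x k +
    ∑ p ∈ Γ.degs x ×ˢ Γ.degs x with p.1 < p.2, ⁅Γ.comp x p.1, Γ.comp x p.2⁆

theorem comp_eq_zero {x : Γ.GrSum} {k : ℕ+} (h : k ∉ Γ.degs x) : Γ.comp x k = 0 := by
  classical
  have h1 : (show ⨁ k : ℕ+, Γ.Gr k from x) k = 0 := DFinsupp.notMem_support_iff.1 h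
  rw [comp, h1, map_zero]

theorem compSq_eq_zero {x : Γ.GrSum} {k : ℕ+} (h : k ∉ Γ.degs x) : Γ.compSq x k = 0 := by
  classical
  have h1 : (show ⨁ k : ℕ+, Γ.Gr k from x) k = 0 := DFinsupp.notMem_support_iff.1 h
  rw [compSq, h1, ← cls_one, sqFun_cls]
  convert map_zero (Γ.incl (2 * k))
  rw [← cls_one]
  congr 1
  exact Subtype.ext (by simp)

theorem comp_add (x y : Γ.GrSum) (k : ℕ+) : Γ.comp (x + y) k = Γ.comp x k + Γ.comp y k :=
  map_add (Γ.incl k) _ _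

theorem compSq_add (x y : Γ.GrSum) (k : ℕ+) :
    Γ.compSq (x + y) k = Γ.compSq x k + Γ.compSq y k + ⁅Γ.comp x k, Γ.comp y k⁆ := by
  have key : ∀ u v : Γ.Gr k, Γ.incl (2 * k) (Γ.sqFun k (u + v)) =
      Γ.incl (2 * k) (Γ.sqFun k u) + Γ.incl (2 * k) (Γ.sqFun k v) + ⁅Γ.incl k u, Γ.incl k v⁆ := by
    intro u v
    obtain ⟨a, rfl⟩ := Γ.cls_surjective k u
    obtain ⟨b, rfl⟩ := Γ.cls_surjective k v
    have e : ⁅Γ.incl k (Γ.cls k a), Γ.incl k (Γ.cls k b)⁆ =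
        - ⁅Γ.incl k (Γ.cls k a), Γ.incl k (Γ.cls k b⁻¹)⁆ := by
      rw [cls_inv, map_neg, lie_neg, neg_neg]
    have hm := Γ.comm_mem a.2 (b⁻¹).2
    rw [← pnat_two_mul] at hm
    rw [e, neg_eq_of_add_eq_zero_left (Γ.add_self_eq_zero _), lie_incl, brk_cls, ← cls_mul,
      sqFun_cls, sqFun_cls, sqFun_cls,
      Γ.incl_cls_congr (pnat_two_mul k).symm _ ⟨_, hm⟩ rfl, add_right_comm, ← map_add, ← map_add,
      ← cls_mul, ← cls_mul]
    congr 2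
    exact Subtype.ext (by simp [pow_two, mul_assoc])
  exact key _ _

theorem sum_comp (x : Γ.GrSum) {S : Finset ℕ+} (hS : Γ.degs x ⊆ S) : ∑ k ∈ S, Γ.comp x k = x := by
  classical
  rw [← Finset.sum_subset hS fun k _ hk => Γ.comp_eq_zero hk]
  exact DirectSum.sum_support_of (show ⨁ k : ℕ+, Γ.Gr k from x)

theorem sqTot_eq (x : Γ.GrSum) {S : Finset ℕ+} (hS : Γ.degs x ⊆ S) :
    Γ.sqTot x = ∑ k ∈ S, Γ.compSq x k +
      ∑ p ∈ S ×ˢ S with p.1 < p.2, ⁅Γ.comp x p.1, Γ.comp x p.2⁆ := by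
  rw [sqTot]
  congr 1
  · exact Finset.sum_subset hS fun k _ hk => Γ.compSq_eq_zero hk
  · refine Finset.sum_subset (Finset.filter_subset_filter _ (Finset.product_subset_product hS hS))
      fun p hp hp' => ?_
    by_cases h1 : p.1 ∈ Γ.degs x
    · by_cases h2 : p.2 ∈ Γ.degs x
      · exact absurd (Finset.mem_filter.2 ⟨Finset.mem_product.2 ⟨h1, h2⟩,
          (Finset.mem_filter.1 hp).2⟩) hp'
      · rw [Γ.comp_eq_zero h2, lie_zero]
    · rw [Γ.comp_eq_zero h1, zero_lie]

theorem sqTot_add (x y : Γ.GrSum) : Γ.sqTot (x + y) = Γ.sqTot x + Γ.sqTot y + ⁅x, y⁆ := by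
  classical
  set S := Γ.degs x ∪ Γ.degs y ∪ Γ.degs (x + y)
  have hx : Γ.degs x ⊆ S := fun k hk => by simp [S, hk]
  have hy : Γ.degs y ⊆ S := fun k hk => by simp [S, hk]
  have hxy : Γ.degs (x + y) ⊆ S := fun k hk => by simp [S, hk]
  have hl : ⁅x, y⁆ = ∑ k ∈ S, ⁅Γ.comp x k, Γ.comp y k⁆ +
      ∑ p ∈ S ×ˢ S with p.1 < p.2, (⁅Γ.comp x p.1, Γ.comp y p.2⁆ + ⁅Γ.comp y p.1, Γ.comp x p.2⁆) := by
    have h0 : ⁅x, y⁆ = ∑ p ∈ S ×ˢ S, ⁅Γ.comp x p.1, Γ.comp y p.2⁆ := by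
      conv_lhs => rw [← Γ.sum_comp x hx, ← Γ.sum_comp y hy, sum_lie]
      rw [Finset.sum_product]
      exact Finset.sum_congr rfl fun k _ => lie_sum _ _ _
    have h1 : ∑ p ∈ S ×ˢ S with p.1 < p.2, ⁅Γ.comp y p.1, Γ.comp x p.2⁆ =
        ∑ p ∈ S ×ˢ S with p.2 < p.1, ⁅Γ.comp x p.1, Γ.comp y p.2⁆ := by
      refine Finset.sum_nbij' Prod.swap Prod.swap ?_ ?_ ?_ ?_ ?_
      · intro p; simp; tauto
      · intro p; simp; tauto
      · intro p _; simp
      · intro p _; simp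
      · intro p _; exact Γ.lie_comm _ _
    have h2 : ∑ k ∈ S, ⁅Γ.comp x k, Γ.comp y k⁆ =
        ∑ p ∈ S ×ˢ S with p.1 = p.2, ⁅Γ.comp x p.1, Γ.comp y p.2⁆ := by
      refine Finset.sum_nbij' (fun k => (k, k)) Prod.fst ?_ ?_ ?_ ?_ ?_
      · intro k; simp
      · intro p; simp; tauto
      · intro k _; rfl
      · rintro ⟨a, b⟩ h; simp at h; simp [h.2]
      · intro k _; rfl
    rw [Finset.sum_add_distrib, h1, h2, h0, ← add_assoc, add_right_comm]
    simp only [Finset.sum_filter, ← Finset.sum_add_distrib]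
    refine Finset.sum_congr rfl fun p _ => ?_
    rcases lt_trichotomy p.1 p.2 with h | h | h
    · simp [h, h.ne, h.not_gt]
    · simp [h]
    · simp [h, h.ne', h.not_gt]
  rw [hl, Γ.sqTot_eq x hx, Γ.sqTot_eq y hy, Γ.sqTot_eq (x + y) hxy]
  simp only [comp_add, compSq_add, Finset.sum_add_distrib, add_lie, lie_add]
  abel

theorem sqTot_incl {k : ℕ+} (u : Γ.Gr k) :
    Γ.sqTot (Γ.incl k u) = Γ.incl (2 * k) (Γ.sqFun k u) := by
  classical
  have hS : Γ.degs (Γ.incl k u) ⊆ {k} := DFinsupp.support_single_subset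
  rw [Γ.sqTot_eq _ hS, Finset.sum_singleton]
  have h1 : ∀ p ∈ (({k} : Finset ℕ+) ×ˢ ({k} : Finset ℕ+)).filter (fun p => p.1 < p.2),
      ⁅Γ.comp (Γ.incl k u) p.1, Γ.comp (Γ.incl k u) p.2⁆ = 0 := by
    rintro ⟨a, b⟩ h
    simp only [Finset.mem_filter, Finset.mem_product, Finset.mem_singleton] at h
    obtain ⟨⟨rfl, rfl⟩, h⟩ := h
    exact absurd h (lt_irrefl _)
  rw [Finset.sum_eq_zero h1, add_zero, compSq]
  congr 2
  exact DirectSum.of_eq_same (β := fun k => Γ.Gr k) k u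

theorem lie_sqTot (x y : Γ.GrSum) : ⁅x, Γ.sqTot y⁆ = ⁅⁅x, y⁆, y⁆ := by
  have hz : Γ.sqTot 0 = 0 := by
    have := Γ.sqTot_add 0 0
    rwa [add_zero, lie_self, add_zero, add_self_eq_zero] at this
  induction y using Γ.induction_on with
  | zero => rw [hz]; simp
  | add y z hy hz =>
    have h := leibniz_lie x y z
    rw [sqTot_add, lie_add, lie_add, hy, hz, h, Γ.lie_comm y ⁅x, z⁆]
    simp only [add_lie, lie_add]
    abel
  | incl l b =>
    induction x using Γ.induction_on with
    | zero => simp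
    | add x x' h h' => rw [add_lie, h, h', add_lie, add_lie]
    | incl k a =>
      have hc := Γ.comm_mem (Γ.comm_mem a.2 b.2) b.2
      have hi : k + l + l = k + 2 * l := by rw [pnat_two_mul, add_assoc]
      rw [hi] at hc
      rw [sqTot_incl, sqFun_cls, lie_incl, brk_cls, lie_incl, brk_cls, lie_incl, brk_cls,
        Γ.incl_cls_congr hi _ ⟨_, hc⟩ rfl]
      congr 1
      rw [cls_eq_iff]
      have hs := Γ.pow_two_mem (Γ.comm_mem a.2 b.2)
      have hle : k + 2 * l + 1 ≤ 2 * (k + l) := by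
        rw [mul_add, pnat_two_mul k, add_right_comm]
        exact add_le_add_left (add_le_add_right (one_le : 1 ≤ k) k) _
      have e : (a : G)⁻¹ * ((b : G) ^ 2)⁻¹ * a * (b : G) ^ 2 =
          ((a : G)⁻¹ * (b : G)⁻¹ * a * b) ^ 2 *
          (((a : G)⁻¹ * (b : G)⁻¹ * a * b)⁻¹ * (b : G)⁻¹ * ((a : G)⁻¹ * (b : G)⁻¹ * a * b) * b) := by
        simp [pow_two, mul_assoc]
      simp only
      rw [e, QuotientGroup.mk_mul, (QuotientGroup.eq_one_iff _).2 (Γ.term_anti hle hs), one_mul]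

noncomputable instance : TwoLieAlgebra Γ.GrSum where
  sq := Γ.sqTot
  lie_sq := Γ.lie_sqTot
  sq_smul c x := by
    obtain rfl | rfl : c = 0 ∨ c = 1 := by revert c; decide
    · have := Γ.sqTot_add 0 0
      rw [add_zero, lie_self, add_zero, add_self_eq_zero] at this
      simp [this]
    · simp
  sq_add := Γ.sqTot_add

/-- The bracket of `gr Γ` on classes of group elements. -/
theorem lie_incl_cls {k l : ℕ+} (g : Γ.term k) (h : Γ.term l) :
    ⁅Γ.incl k (Γ.cls k g), Γ.incl l (Γ.cls l h)⁆ =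
      Γ.incl (k + l) (Γ.cls (k + l) ⟨(g : G)⁻¹ * (h : G)⁻¹ * g * h, Γ.comm_mem g.2 h.2⟩) :=
  Γ.lie_incl _ _

/-- The 2-power operation of `gr Γ` on classes of group elements. -/
theorem sq_incl_cls {k : ℕ+} (g : Γ.term k) :
    TwoLieAlgebra.sq (Γ.incl k (Γ.cls k g)) =
      Γ.incl (2 * k) (Γ.cls (2 * k) ⟨(g : G) ^ 2, Γ.pow_two_mem g.2⟩) :=
  Γ.sqTot_incl _

end

end TwoCentralSeries

/-! ### Right-angled Coxeter groups and the presented 2-Lie algebra -/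

/-- The relators `a_i²` and `(a_i, a_j)`, `{i, j} ∈ K`, of the right-angled Coxeter group. -/
def racgRels {m : ℕ} (K : AbstractSimplicialComplex (Fin m)) : Set (FreeGroup (Fin m)) :=
  {r | ∃ i, r = FreeGroup.of i ^ 2} ∪
  {r | ∃ i j, ({i, j} : Finset (Fin m)) ∈ K ∧
    r = (FreeGroup.of i)⁻¹ * (FreeGroup.of j)⁻¹ * FreeGroup.of i * FreeGroup.of j}

/-- The right-angled Coxeter group
`RC_K = F(a_1, …, a_m) / (a_i² = 1, a_i a_j = a_j a_i for {i, j} ∈ K)`. -/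
abbrev RACG {m : ℕ} (K : AbstractSimplicialComplex (Fin m)) : Type :=
  PresentedGroup (racgRels K)

/-- The relators `u_i^[2]` and `[u_i, u_j]`, `{i, j} ∈ K`, in the free 2-Lie algebra. -/
def racgLieRels {m : ℕ} (K : AbstractSimplicialComplex (Fin m)) : Set (FreeTwoLie (Fin m)) :=
  {r | ∃ i, r = TwoLieAlgebra.sq (FreeTwoLie.of i)} ∪
  {r | ∃ i j, ({i, j} : Finset (Fin m)) ∈ K ∧ r = ⁅FreeTwoLie.of i, FreeTwoLie.of j⁆}

/-- The 2-Lie algebra `FL_2(u_1, …, u_m) / (u_i^[2] = 0, [u_i, u_j] = 0 for {i, j} ∈ K)`. -/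
abbrev RACGLie {m : ℕ} (K : AbstractSimplicialComplex (Fin m)) : Type :=
  (TwoLieIdeal.span (racgLieRels K)).Quot

/-!
Let `L` be the presented 2-Lie algebra and `γ` the lower 2-central series of the right-angled Coxeter
group. The relations of `L` hold in `gr γ` for the classes of the generators `a_i` in degree one, so
`u_i ↦ a_i` defines a homomorphism `L → gr γ` (`RACG.exists_toGr`). It is bijective for the following
reasons.

*Surjectivity.* For a 2-Lie subalgebra `T` of `gr γ` containing degree one, the elements of `γ_k`
whose class lies in `T` form a 2-central series. As `γ` is the smallest one, `T` is everything
(`RACG.mem_of_deg1_mem`).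

*Injectivity.* Let `Env L` be the restricted enveloping algebra. As `u_i² = 0` in it, the elements
`1 + u_i X` of `(Env L)[X]` are involutions, and they satisfy the relations of the group. Leading
coefficients of this Magnus representation give a map `gr γ → Env L` under which brackets become
commutators and 2-powers become squares (`RACG.exists_leadingCoeff`). The composite `L → gr γ → Env L`
is the canonical map, so it remains to show that `L` embeds in `Env L` (`RACGLie.envι_injective`).

This instance of the Poincaré–Birkhoff–Witt theorem needs no ordered monomials. If `I` is the kernel
of a nonzero restricted character of a 2-Lie algebra `S = I ⊕ 𝔽₂ e`, then the derivation `ad e`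
extends to `Env I`, and `S` acts on `Env I ⊕ Env I · e`. Hence the kernel of `S → Env S` is contained
in that of `I → Env I` (`TwoLieSubalgebra.envKer_subset_envKer_kerInf`). Now `L` is graded: the
grading is the homomorphism `u_i ↦ X ⊗ u_i` to `𝔽₂[X] ⊗ L`. Its homogeneous components are finite, so
finitely many such steps lead from `L_{≥ n}` to `L_{≥ n+1}`, and the kernel of `L → Env L` lies in
the intersection of all `L_{≥ n}`, which is zero.
-/

/-! ### The restricted enveloping algebra -/

namespace TwoLieAlgebra

section

variable {L : Type*} [LieRing L] [LieAlgebra (ZMod 2) L] [TwoLieAlgebra L]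

theorem sq_zero : sq (0 : L) = 0 := by
  simpa using sq_smul (0 : ZMod 2) (0 : L)

theorem lie_comm {L : Type*} [LieRing L] [LieAlgebra (ZMod 2) L] (x y : L) : ⁅x, y⁆ = ⁅y, x⁆ := by
  rw [← lie_skew, ZModModule.neg_eq_self]

variable (L) in
/-- The defining relations `x * x = x^[2]` of the restricted enveloping algebra. -/
inductive EnvRel : TensorAlgebra (ZMod 2) L → TensorAlgebra (ZMod 2) L → Prop
  | mul_self (x : L) :
    EnvRel (TensorAlgebra.ι (ZMod 2) x * TensorAlgebra.ι (ZMod 2) x)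
      (TensorAlgebra.ι (ZMod 2) (sq x))

variable (L) in
/-- The restricted enveloping algebra of a 2-Lie algebra: the tensor algebra modulo the relations
`x * x = x^[2]`. The relations `x * y - y * x = [x, y]` follow by polarization. -/
abbrev Env : Type _ := RingQuot (EnvRel L)

/-- The canonical map of a 2-Lie algebra to its restricted enveloping algebra. -/
def envι : L →ₗ[ZMod 2] Env L :=
  (RingQuot.mkAlgHom (ZMod 2) (EnvRel L)).toLinearMap ∘ₗ TensorAlgebra.ι (ZMod 2)

theorem envι_mul_self (x : L) : envι x * envι x = envι (sq x) := by
  have h := RingQuot.mkAlgHom_rel (ZMod 2) (EnvRel.mul_self x)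
  rwa [map_mul] at h

/-- A linear map to an associative algebra taking 2-powers to squares takes brackets to
commutators; the signs do not matter in characteristic two. -/
theorem map_lie_of_mul_self {A : Type*} [Ring A] [Algebra (ZMod 2) A] (f : L →ₗ[ZMod 2] A)
    (hf : ∀ x, f x * f x = f (sq x)) (x y : L) : f ⁅x, y⁆ = f x * f y + f y * f x := by
  have h := hf (x + y)
  rw [sq_add, map_add, map_add, map_add, ← hf, ← hf, add_mul, mul_add, mul_add] at h
  have h2 : f x * f y + f y * f x + (f x * f x + f y * f y) =
      f ⁅x, y⁆ + (f x * f x + f y * f y) := by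
    rw [add_comm (f ⁅x, y⁆), ← h]; abel
  exact (add_right_cancel h2).symm

theorem envι_lie (x y : L) : envι ⁅x, y⁆ = envι x * envι y + envι y * envι x :=
  map_lie_of_mul_self envι envι_mul_self x y

/-- The universal property of the restricted enveloping algebra. -/
def envLift {A : Type*} [Ring A] [Algebra (ZMod 2) A] (f : L →ₗ[ZMod 2] A)
    (hf : ∀ x, f x * f x = f (sq x)) : Env L →ₐ[ZMod 2] A :=
  RingQuot.liftAlgHom (ZMod 2) ⟨TensorAlgebra.lift (ZMod 2) f, by
    rintro _ _ ⟨x⟩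
    rw [map_mul, TensorAlgebra.lift_ι_apply, TensorAlgebra.lift_ι_apply, hf]⟩

theorem envLift_ι {A : Type*} [Ring A] [Algebra (ZMod 2) A] (f : L →ₗ[ZMod 2] A)
    (hf : ∀ x, f x * f x = f (sq x)) (x : L) : envLift f hf (envι x) = f x := by
  rw [envLift, envι, LinearMap.comp_apply, AlgHom.toLinearMap_apply,
    RingQuot.liftAlgHom_mkAlgHom_apply, TensorAlgebra.lift_ι_apply]

theorem env_induction {motive : Env L → Prop} (b : Env L)
    (algebraMap : ∀ r, motive (algebraMap (ZMod 2) _ r)) (ι : ∀ x, motive (envι x))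
    (mul : ∀ a b, motive a → motive b → motive (a * b))
    (add : ∀ a b, motive a → motive b → motive (a + b)) : motive b := by
  obtain ⟨t, rfl⟩ := RingQuot.mkAlgHom_surjective (ZMod 2) (EnvRel L) b
  induction t using TensorAlgebra.induction with
  | algebraMap r => rw [AlgHom.commutes]; exact algebraMap r
  | ι x => exact ι x
  | mul a b ha hb => rw [map_mul]; exact mul _ _ ha hb
  | add a b ha hb => rw [map_add]; exact add _ _ ha hb

/-- The augmentation sends `L` to zero, so `1 ≠ 0` in the enveloping algebra. -/
instance : Nontrivial (Env L) :=
  (envLift (A := ZMod 2) (0 : L →ₗ[ZMod 2] ZMod 2) (by simp)).toRingHom.domain_nontrivial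

/-- Functoriality of the enveloping algebra, as far as it concerns the kernel of `envι`. -/
theorem envι_map_eq_zero {M : Type*} [LieRing M] [LieAlgebra (ZMod 2) M] [TwoLieAlgebra M]
    (f : L →ₗ[ZMod 2] M) (hf : ∀ x, f (sq x) = sq (f x)) {x : L} (hx : envι x = 0) :
    envι (f x) = 0 := by
  have h := envLift_ι (envι ∘ₗ f) (fun x => by simp [hf, envι_mul_self]) x
  rw [hx, map_zero] at h
  exact h.symm

section Derivation

variable (d : L →ₗ[ZMod 2] L) (hd : ∀ x, d (sq x) = ⁅x, d x⁆)

/-- The homomorphism `b ↦ b + D b ε` to the dual numbers, for the derivation `D` of the enveloping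
algebra that extends a restricted derivation `d` of `L`. -/
def envDual : Env L →ₐ[ZMod 2] TrivSqZeroExt (Env L) (Env L) :=
  envLift ((TrivSqZeroExt.inlHom (Env L) (Env L)).toAddMonoidHom.toZModLinearMap 2 ∘ₗ envι +
    (TrivSqZeroExt.inrHom (Env L) (Env L)).toAddMonoidHom.toZModLinearMap 2 ∘ₗ envι ∘ₗ d) (by
      intro x
      ext
      · simp [envι_mul_self]
      · simp [hd, envι_lie, add_comm])

/-- The extension of a restricted derivation to the enveloping algebra. -/
def envDer : Env L →+ Env L where
  toFun b := (envDual d hd b).snd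
  map_zero' := by simp
  map_add' := by simp

theorem envDer_ι (x : L) : envDer d hd (envι x) = envι (d x) := by
  change (envDual d hd (envι x)).snd = _
  rw [envDual, envLift_ι]
  simp

theorem envDer_algebraMap (r : ZMod 2) : envDer d hd (algebraMap _ _ r) = 0 := by
  change (envDual d hd (algebraMap _ _ r)).snd = _
  rw [AlgHom.commutes]
  rfl

theorem fst_envDual (b : Env L) : (envDual d hd b).fst = b := by
  induction b using env_induction with
  | algebraMap r => rw [AlgHom.commutes]; rfl
  | ι x => rw [envDual, envLift_ι]; simp
  | mul a b ha hb => rw [map_mul, TrivSqZeroExt.fst_mul, ha, hb]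
  | add a b ha hb => rw [map_add, TrivSqZeroExt.fst_add, ha, hb]

theorem envDer_mul (a b : Env L) :
    envDer d hd (a * b) = a * envDer d hd b + envDer d hd a * b := by
  change (envDual d hd (a * b)).snd = _
  rw [map_mul, TrivSqZeroExt.snd_mul, fst_envDual, fst_envDual]
  rfl

/-- If `d` squares to an inner derivation, then so does its extension. -/
theorem envDer_envDer (c : L) (hc : ∀ x, d (d x) = ⁅c, x⁆) (b : Env L) :
    envDer d hd (envDer d hd b) = envι c * b + b * envι c := by
  induction b using env_induction with
  | algebraMap r =>
    rw [envDer_algebraMap, map_zero, Algebra.commutes, ZModModule.add_self]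
  | ι x => rw [envDer_ι, envDer_ι, hc, envι_lie]
  | mul a b ha hb =>
    have e : envDer d hd (envDer d hd (a * b)) = a * envDer d hd (envDer d hd b) +
        envDer d hd (envDer d hd a) * b +
        (envDer d hd a * envDer d hd b + envDer d hd a * envDer d hd b) := by
      rw [envDer_mul, map_add, envDer_mul, envDer_mul]; abel
    have e2 : a * (envι c * b) + a * (envι c * b) = 0 := ZModModule.add_self _
    rw [e, ZModModule.add_self, add_zero, ha, hb, mul_add, add_mul]
    calc _ = envι c * (a * b) + (a * b) * envι c + (a * (envι c * b) + a * (envι c * b)) := by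
          noncomm_ring
      _ = _ := by rw [e2, add_zero]
  | add a b ha hb => rw [map_add, map_add, ha, hb]; noncomm_ring

end Derivation

end

end TwoLieAlgebra

/-! ### Passing to the kernel of a restricted character -/

/-- A subalgebra of a 2-Lie algebra: a Lie subalgebra closed under the 2-power operation. -/
structure TwoLieSubalgebra (L : Type*) [LieRing L] [LieAlgebra (ZMod 2) L] [TwoLieAlgebra L]
    extends LieSubalgebra (ZMod 2) L where
  sq_mem : ∀ x ∈ toLieSubalgebra, TwoLieAlgebra.sq x ∈ toLieSubalgebra

namespace TwoLieSubalgebra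

open TwoLieAlgebra

section

variable {L : Type*} [LieRing L] [LieAlgebra (ZMod 2) L] [TwoLieAlgebra L]

instance (S : TwoLieSubalgebra L) : TwoLieAlgebra S.toLieSubalgebra where
  sq x := ⟨sq (x : L), S.sq_mem x x.2⟩
  lie_sq x y := Subtype.ext (TwoLieAlgebra.lie_sq (x : L) y)
  sq_smul a x := Subtype.ext (TwoLieAlgebra.sq_smul a (x : L))
  sq_add x y := Subtype.ext (TwoLieAlgebra.sq_add (x : L) y)

theorem coe_sq (S : TwoLieSubalgebra L) (x : S.toLieSubalgebra) :
    ((sq x : S.toLieSubalgebra) : L) = sq (x : L) := rfl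

/-- The elements of a subalgebra `S` that vanish in the restricted enveloping algebra of `S`. -/
def envKer (S : TwoLieSubalgebra L) : Set L :=
  {x | ∃ h : x ∈ S.toLieSubalgebra, envι (⟨x, h⟩ : S.toLieSubalgebra) = 0}

theorem envKer_mono {S T : TwoLieSubalgebra L} (h : S.toLieSubalgebra ≤ T.toLieSubalgebra) :
    S.envKer ⊆ T.envKer := by
  rintro x ⟨hxS, hx⟩
  refine ⟨h hxS, ?_⟩
  exact envι_map_eq_zero (L := S.toLieSubalgebra) (M := T.toLieSubalgebra)
    (LinearMap.codRestrict T.toSubmodule S.toSubmodule.subtype fun y => h y.2) (fun _ => rfl) hx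

/-- The part of a subalgebra `S` on which a linear form vanishes, when the form is a restricted
character of `S`. -/
def kerInf (S : TwoLieSubalgebra L) (f : L →ₗ[ZMod 2] ZMod 2)
    (hlie : ∀ x ∈ S.toLieSubalgebra, ∀ y ∈ S.toLieSubalgebra, f ⁅x, y⁆ = 0)
    (hsq : ∀ x ∈ S.toLieSubalgebra, f (sq x) = 0) : TwoLieSubalgebra L where
  toSubmodule := S.toSubmodule ⊓ LinearMap.ker f
  lie_mem' := fun {x y} hx hy => ⟨S.lie_mem hx.1 hy.1, hlie x hx.1 y hy.1⟩
  sq_mem x hx := ⟨S.sq_mem x hx.1, hsq x hx.1⟩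

section Extension

variable {I : Type*} [LieRing I] [LieAlgebra (ZMod 2) I] [TwoLieAlgebra I]
  (d : I →ₗ[ZMod 2] I) (hd : ∀ x, d (sq x) = ⁅x, d x⁆)

/-- Left multiplication by `e` on the free left module `Env I ⊕ Env I · e`, where `e * b - b * e` is
the value at `b` of the derivation extending `d`, and `e² = c`. -/
def extOp (c : I) : Module.End (ZMod 2) (Env I × Env I) :=
  AddMonoidHom.toZModLinearMap 2
    { toFun := fun p => (envDer d hd p.1 + p.2 * envι c, p.1 + envDer d hd p.2)
      map_zero' := by simp
      map_add' := fun p q => by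
        ext
        · simp only [Prod.fst_add, Prod.snd_add, map_add, add_mul]; abel
        · simp only [Prod.fst_add, Prod.snd_add, map_add]; abel }

theorem extOp_apply (c : I) (p : Env I × Env I) :
    extOp d hd c p = (envDer d hd p.1 + p.2 * envι c, p.1 + envDer d hd p.2) := rfl

/-- The operator squares to left multiplication by `c` as soon as `d² = ad c` and `d c = 0`, the
identities satisfied by `d = ad e` and `c = e^[2]`. -/
theorem extOp_mul_self (c : I) (hc : ∀ x, d (d x) = ⁅c, x⁆) (hdc : d c = 0) :
    extOp d hd c * extOp d hd c = Algebra.lsmul (ZMod 2) (ZMod 2) (Env I × Env I) (envι c) := by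
  have h0 : envDer d hd (envι c) = 0 := by rw [envDer_ι, hdc, map_zero]
  refine LinearMap.ext fun p => Prod.ext ?_ ?_
  · simp only [Module.End.mul_apply, extOp_apply, map_add, envDer_mul, h0, mul_zero, zero_add,
      envDer_envDer d hd c hc, Algebra.lsmul_coe, Prod.smul_fst, smul_eq_mul, add_mul]
    have h1 := ZModModule.add_self (p.1 * envι c)
    have h2 := ZModModule.add_self (envDer d hd p.2 * envι c)
    calc _ = envι c * p.1 + (p.1 * envι c + p.1 * envι c) +
        (envDer d hd p.2 * envι c + envDer d hd p.2 * envι c) := by abel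
      _ = _ := by rw [h1, h2, add_zero, add_zero]
  · simp only [Module.End.mul_apply, extOp_apply, map_add,
      envDer_envDer d hd c hc, Algebra.lsmul_coe, Prod.smul_snd, smul_eq_mul]
    have h1 := ZModModule.add_self (p.2 * envι c)
    have h2 := ZModModule.add_self (envDer d hd p.1)
    calc _ = envι c * p.2 + (p.2 * envι c + p.2 * envι c) +
        (envDer d hd p.1 + envDer d hd p.1) := by abel
      _ = _ := by rw [h1, h2, add_zero, add_zero]

/-- The commutator of the operator with left multiplication by `x` is left multiplication
by `d x`. -/
theorem extOp_comm (c x : I) :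
    extOp d hd c * Algebra.lsmul (ZMod 2) (ZMod 2) (Env I × Env I) (envι x) +
      Algebra.lsmul (ZMod 2) (ZMod 2) (Env I × Env I) (envι x) * extOp d hd c =
      Algebra.lsmul (ZMod 2) (ZMod 2) (Env I × Env I) (envι (d x)) := by
  refine LinearMap.ext fun p => Prod.ext ?_ ?_
  · simp only [Module.End.mul_apply, extOp_apply, LinearMap.add_apply, envDer_mul, envDer_ι,
      Algebra.lsmul_coe, Prod.smul_fst, Prod.smul_snd, Prod.fst_add, smul_eq_mul, mul_add]
    have h1 := ZModModule.add_self (envι x * envDer d hd p.1)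
    have h2 := ZModModule.add_self (envι x * p.2 * envι c)
    calc _ = envι (d x) * p.1 + (envι x * envDer d hd p.1 + envι x * envDer d hd p.1) +
        (envι x * p.2 * envι c + envι x * p.2 * envι c) := by rw [← mul_assoc]; abel
      _ = _ := by rw [h1, h2, add_zero, add_zero]
  · simp only [Module.End.mul_apply, extOp_apply, LinearMap.add_apply, envDer_mul, envDer_ι,
      Algebra.lsmul_coe, Prod.smul_fst, Prod.smul_snd, Prod.snd_add, smul_eq_mul, mul_add]
    have h1 := ZModModule.add_self (envι x * envDer d hd p.2)
    have h2 := ZModModule.add_self (envι x * p.1)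
    calc _ = envι (d x) * p.2 + (envι x * envDer d hd p.2 + envι x * envDer d hd p.2) +
        (envι x * p.1 + envι x * p.1) := by abel
      _ = _ := by rw [h1, h2, add_zero, add_zero]

theorem lsmul_add_extOp_apply_one (c y : I) (r : ZMod 2) :
    (Algebra.lsmul (ZMod 2) (ZMod 2) (Env I × Env I) (envι y) + r • extOp d hd c) (1, 0) =
      (envι y, r • (1 : Env I)) := by
  have hD1 : envDer d hd 1 = 0 := by
    rw [← map_one (algebraMap (ZMod 2) _), envDer_algebraMap]
  rw [LinearMap.add_apply, LinearMap.smul_apply, extOp_apply, hD1]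
  ext <;> simp

end Extension

/-- The codimension-one step of the Poincaré–Birkhoff–Witt theorem: passing from a subalgebra to
the kernel `I` of a restricted character does not shrink the kernel of the map to the enveloping
algebra. If the character is nonzero, the subalgebra is `I ⊕ 𝔽₂ e`, and it acts on
`Env I ⊕ Env I · e`; the action on `1` detects both the value of the character and the image of an
element of `I` in `Env I`. -/
theorem envKer_subset_envKer_kerInf (S : TwoLieSubalgebra L) (f : L →ₗ[ZMod 2] ZMod 2)
    (hlie : ∀ x ∈ S.toLieSubalgebra, ∀ y ∈ S.toLieSubalgebra, f ⁅x, y⁆ = 0)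
    (hsq : ∀ x ∈ S.toLieSubalgebra, f (sq x) = 0) :
    S.envKer ⊆ (S.kerInf f hlie hsq).envKer := by
  rintro x ⟨hxS, hx⟩
  by_cases hf : ∀ y ∈ S.toLieSubalgebra, f y = 0
  · exact envKer_mono (T := S.kerInf f hlie hsq) (fun y hy => ⟨hy, hf y hy⟩) ⟨hxS, hx⟩
  push Not at hf
  obtain ⟨e, he, hfe⟩ := hf
  replace hfe : f e = 1 := by
    generalize f e = c at hfe
    revert c; decide
  set I := S.kerInf f hlie hsq
  have hlie' : ∀ y ∈ I.toLieSubalgebra, ⁅e, y⁆ ∈ I.toLieSubalgebra := fun y hy =>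
    ⟨S.lie_mem he hy.1, hlie e he y hy.1⟩
  obtain ⟨d, d_coe⟩ : ∃ d : I.toLieSubalgebra →ₗ[ZMod 2] I.toLieSubalgebra,
      ∀ y, (d y : L) = ⁅e, (y : L)⁆ :=
    ⟨LinearMap.codRestrict I.toSubmodule
      ((LieModule.toEnd (ZMod 2) L L e : L →ₗ[ZMod 2] L) ∘ₗ I.toSubmodule.subtype)
      fun y => hlie' y y.2, fun _ => rfl⟩
  let c : I.toLieSubalgebra := ⟨sq e, S.sq_mem e he, hsq e he⟩
  have hd : ∀ y, d (sq y) = ⁅y, d y⁆ := fun y => Subtype.ext (by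
    rw [d_coe, coe_sq, LieSubalgebra.coe_bracket, d_coe, TwoLieAlgebra.lie_sq]
    exact TwoLieAlgebra.lie_comm _ _)
  have hc : ∀ y, d (d y) = ⁅c, y⁆ := fun y => Subtype.ext (by
    rw [d_coe, d_coe, LieSubalgebra.coe_bracket, TwoLieAlgebra.lie_comm (c : L),
      TwoLieAlgebra.lie_sq, TwoLieAlgebra.lie_comm e, TwoLieAlgebra.lie_comm e])
  have hdc : d c = 0 := Subtype.ext (by
    rw [d_coe, TwoLieAlgebra.lie_sq, lie_self, zero_lie]; rfl)
  -- The projection of `S = I ⊕ 𝔽₂ e` to `I`; there are no signs in characteristic two.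
  obtain ⟨π, π_coe⟩ : ∃ π : S.toLieSubalgebra →ₗ[ZMod 2] I.toLieSubalgebra,
      ∀ y, (π y : L) = (y : L) + f (y : L) • e :=
    ⟨LinearMap.codRestrict I.toSubmodule
      (S.toSubmodule.subtype + (f ∘ₗ S.toSubmodule.subtype).smulRight e) fun y =>
        ⟨S.toSubmodule.add_mem y.2 (S.toSubmodule.smul_mem _ he), by
          change f ((y : L) + f (y : L) • e) = 0
          rw [map_add, map_smul, hfe, smul_eq_mul, mul_one, ZModModule.add_self]⟩,
      fun _ => rfl⟩
  let lm : Env I.toLieSubalgebra →ₐ[ZMod 2]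
      Module.End (ZMod 2) (Env I.toLieSubalgebra × Env I.toLieSubalgebra) :=
    Algebra.lsmul (ZMod 2) (ZMod 2) (Env I.toLieSubalgebra × Env I.toLieSubalgebra)
  obtain ⟨ρ, ρ_apply⟩ : ∃ ρ : S.toLieSubalgebra →ₗ[ZMod 2]
      Module.End (ZMod 2) (Env I.toLieSubalgebra × Env I.toLieSubalgebra),
      ∀ y, ρ y = lm (envι (π y)) + f (y : L) • extOp d hd c :=
    ⟨lm.toLinearMap ∘ₗ envι ∘ₗ π + (f ∘ₗ S.toSubmodule.subtype).smulRight (extOp d hd c),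
      fun _ => rfl⟩
  have hρ : ∀ y, ρ y * ρ y = ρ (sq y) := by
    intro y
    have hfs : f ((sq y : S.toLieSubalgebra) : L) = 0 := hsq y y.2
    obtain h | h : f (y : L) = 0 ∨ f (y : L) = 1 := by
      generalize f (y : L) = c; revert c; decide
    · have e1 : π (sq y) = sq (π y) := Subtype.ext (by
        rw [π_coe, hfs, coe_sq, coe_sq, π_coe, h, zero_smul, add_zero, add_zero])
      rw [ρ_apply, ρ_apply, hfs, h, zero_smul, add_zero, add_zero, e1, ← map_mul, envι_mul_self]
    · have e1 : π (sq y) = sq (π y) + c + d (π y) := Subtype.ext (by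
        have hy : (y : L) = (π y : L) + e := by
          rw [π_coe, h, one_smul, add_assoc, ZModModule.add_self, add_zero]
        rw [π_coe, hfs, zero_smul, add_zero, coe_sq]
        conv_lhs => rw [hy, TwoLieAlgebra.sq_add, TwoLieAlgebra.lie_comm, ← d_coe]
        rfl)
      have e2 : lm (envι (π (sq y))) = lm (envι (π y)) * lm (envι (π y)) +
          extOp d hd c * extOp d hd c +
          (extOp d hd c * lm (envι (π y)) + lm (envι (π y)) * extOp d hd c) := by
        rw [extOp_mul_self d hd c hc hdc, extOp_comm d hd c, ← map_mul lm, envι_mul_self, e1]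
        simp only [map_add]
        rfl
      rw [ρ_apply, ρ_apply, hfs, h, zero_smul, add_zero, one_smul, e2]
      generalize lm (envι (π y)) = a
      generalize extOp d hd c = b
      rw [add_mul, mul_add, mul_add]
      abel
  have h0 : ρ ⟨x, hxS⟩ = 0 := by
    have h := envLift_ι (L := S.toLieSubalgebra)
      (A := Module.End (ZMod 2) (Env I.toLieSubalgebra × Env I.toLieSubalgebra)) ρ hρ ⟨x, hxS⟩
    rw [hx, map_zero] at h
    exact h.symm
  have h1 : ρ ⟨x, hxS⟩ (1, 0) = 0 := by rw [h0]; rfl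
  rw [ρ_apply, lsmul_add_extOp_apply_one, Prod.mk_eq_zero] at h1
  have hfx : f x = 0 := by
    by_contra h
    exact (smul_ne_zero h one_ne_zero) h1.2
  refine ⟨⟨hxS, hfx⟩, ?_⟩
  refine Eq.trans (congrArg envι ?_) h1.1
  exact Subtype.ext (by rw [π_coe]; change x = x + f x • e; rw [hfx, zero_smul, add_zero])

end

end TwoLieSubalgebra

/-! ### The universal property of the presented 2-Lie algebra -/

theorem TwoLieIdeal.subset_span {L : Type*} [LieRing L] [LieAlgebra (ZMod 2) L] [TwoLieAlgebra L]
    (S : Set L) : S ⊆ (TwoLieIdeal.span S).toLieSubmodule := by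
  intro x hx
  rw [TwoLieIdeal.span, LieSubmodule.coe_sInf, Set.mem_iInter₂]
  exact fun J hJ => hJ.1 hx

namespace RACGLie

open TwoLieAlgebra

section

variable {m : ℕ} {K : AbstractSimplicialComplex (Fin m)}

variable (K) in
/-- The generator `u_i` of the presented 2-Lie algebra. -/
def gen (i : Fin m) : RACGLie K := (TwoLieIdeal.span (racgLieRels K)).proj (FreeTwoLie.of i)

theorem induction {motive : RACGLie K → Prop} (x : RACGLie K) (gen : ∀ i, motive (gen K i))
    (zero : motive 0) (add : ∀ x y, motive x → motive y → motive (x + y))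
    (lie : ∀ x y, motive x → motive y → motive ⁅x, y⁆)
    (sq : ∀ x, motive x → motive (sq x)) : motive x := by
  obtain ⟨⟨a⟩, rfl⟩ := TwoLieIdeal.proj_surjective _ x
  induction a with
  | of i => exact gen i
  | zero => exact zero
  | add a b ha hb => exact add _ _ ha hb
  | lie a b ha hb => exact lie _ _ ha hb
  | sq a ha => exact sq _ ha

theorem sq_gen (i : Fin m) : sq (gen K i) = 0 := by
  rw [gen, ← TwoLieIdeal.proj_sq, TwoLieIdeal.proj_eq_zero]
  exact TwoLieIdeal.subset_span _ (Or.inl ⟨i, rfl⟩)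

theorem lie_gen {i j : Fin m} (h : ({i, j} : Finset (Fin m)) ∈ K) :
    ⁅gen K i, gen K j⁆ = 0 := by
  rw [gen, gen, ← LieHom.map_lie, TwoLieIdeal.proj_eq_zero]
  exact TwoLieIdeal.subset_span _ (Or.inr ⟨i, j, h, rfl⟩)

/-- The universal property of the presented 2-Lie algebra. -/
theorem exists_lift {M : Type*} [LieRing M] [LieAlgebra (ZMod 2) M] [TwoLieAlgebra M]
    (f : Fin m → M) (hsq : ∀ i, sq (f i) = 0)
    (hlie : ∀ i j, ({i, j} : Finset (Fin m)) ∈ K → ⁅f i, f j⁆ = 0) :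
    ∃ φ : RACGLie K →ₗ⁅ZMod 2⁆ M, (∀ x, φ (sq x) = sq (φ x)) ∧ ∀ i, φ (gen K i) = f i := by
  obtain ⟨φ, ⟨φsq, φof⟩, -⟩ := FreeTwoLie.existsUnique_lift f
  have hker : (TwoLieIdeal.span (racgLieRels K)).toLieSubmodule ≤ φ.ker := by
    refine sInf_le ⟨?_, fun x hx => ?_⟩
    · rintro _ (⟨i, rfl⟩ | ⟨i, j, h, rfl⟩)
      · exact φ.mem_ker.2 (by rw [φsq, φof, hsq])
      · exact φ.mem_ker.2 (by rw [LieHom.map_lie, φof, φof, hlie i j h])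
    · rw [LieHom.mem_ker] at hx ⊢
      rw [φsq, hx, sq_zero]
  let ψ : RACGLie K →ₗ[ZMod 2] M :=
    Submodule.liftQ (TwoLieIdeal.span (racgLieRels K)).toLieSubmodule.toSubmodule
      (φ : FreeTwoLie (Fin m) →ₗ[ZMod 2] M) fun x hx => φ.mem_ker.1 (hker hx)
  have hψ : ∀ x, ψ ((TwoLieIdeal.span (racgLieRels K)).proj x) = φ x := fun _ => rfl
  refine ⟨{ ψ with map_lie' := ?_ }, ?_, φof⟩
  · intro x y
    obtain ⟨x, rfl⟩ := TwoLieIdeal.proj_surjective _ x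
    obtain ⟨y, rfl⟩ := TwoLieIdeal.proj_surjective _ y
    exact φ.map_lie x y
  · intro x
    obtain ⟨x, rfl⟩ := TwoLieIdeal.proj_surjective _ x
    exact φsq x

end

end RACGLie

/-! ### The associated graded is generated in degree one -/

namespace RACG

open TwoLieAlgebra

section

variable {m : ℕ} {K : AbstractSimplicialComplex (Fin m)}

/-- The class in degree one of a group element. -/
noncomputable def deg1 {G : Type*} [Group G] (Γ : TwoCentralSeries G) (g : G) : Γ.GrSum :=
  Γ.incl 1 (Γ.cls 1 ⟨g, by rw [Γ.term_one]; trivial⟩)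

variable (K) in
/-- The homomorphism from the presented 2-Lie algebra to the associated graded, taking the
generators `u_i` to the classes of the generators `a_i`. -/
theorem exists_toGr :
    ∃ φ : RACGLie K →ₗ⁅ZMod 2⁆ (lowerTwoCentralSeries (RACG K)).GrSum,
      (∀ x, φ (sq x) = sq (φ x)) ∧
        ∀ i, φ (RACGLie.gen K i) = deg1 _ (PresentedGroup.of i) := by
  have incl_cls_one : ∀ (k : ℕ+) (g : (lowerTwoCentralSeries (RACG K)).term k), (g : RACG K) = 1 →
      (lowerTwoCentralSeries (RACG K)).incl k ((lowerTwoCentralSeries (RACG K)).cls k g) = 0 := by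
    intro k g hg
    rw [show g = 1 from Subtype.ext hg, TwoCentralSeries.cls_one, map_zero]
  refine RACGLie.exists_lift _ (fun i => ?_) fun i j hij => ?_
  · rw [deg1, TwoCentralSeries.sq_incl_cls]
    exact incl_cls_one _ _ (PresentedGroup.one_of_mem (Or.inl ⟨i, rfl⟩))
  · rw [deg1, deg1, TwoCentralSeries.lie_incl_cls]
    exact incl_cls_one _ _ (PresentedGroup.one_of_mem (Or.inr ⟨i, j, hij, rfl⟩))

/-- The associated graded of the lower 2-central series is generated in degree one: the elements of
`γ_k` whose class lies in a given 2-Lie subalgebra containing degree one form a 2-central series,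
which contains the lower one. -/
theorem mem_of_deg1_mem {G : Type*} [Group G]
    (T : TwoLieSubalgebra (lowerTwoCentralSeries G).GrSum)
    (hT : ∀ g : G, deg1 (lowerTwoCentralSeries G) g ∈ T.toLieSubalgebra)
    (x : (lowerTwoCentralSeries G).GrSum) : x ∈ T.toLieSubalgebra := by
  let γ := lowerTwoCentralSeries G
  let Δ : TwoCentralSeries G :=
    { term := fun k =>
        { carrier := {g | ∃ h : g ∈ γ.term k, γ.incl k (γ.cls k ⟨g, h⟩) ∈ T.toLieSubalgebra}
          one_mem' := ⟨(γ.term k).one_mem, by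
            change γ.incl k (γ.cls k 1) ∈ _
            rw [TwoCentralSeries.cls_one, map_zero]
            exact zero_mem _⟩
          mul_mem' := by
            rintro g h ⟨hg, hg'⟩ ⟨hh, hh'⟩
            refine ⟨mul_mem hg hh, ?_⟩
            change γ.incl k (γ.cls k (⟨g, hg⟩ * ⟨h, hh⟩)) ∈ _
            rw [TwoCentralSeries.cls_mul, map_add]
            exact add_mem hg' hh'
          inv_mem' := by
            rintro g ⟨hg, hg'⟩
            refine ⟨inv_mem hg, ?_⟩
            change γ.incl k (γ.cls k (⟨g, hg⟩⁻¹)) ∈ _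
            rw [TwoCentralSeries.cls_inv, map_neg]
            exact neg_mem hg' }
      term_one := by
        refine eq_top_iff.2 fun g _ => ?_
        exact ⟨by rw [γ.term_one]; trivial, hT g⟩
      term_succ_le := by
        rintro k g ⟨hg, -⟩
        refine ⟨γ.term_succ_le k hg, ?_⟩
        have h0 : γ.cls k ⟨g, γ.term_succ_le k hg⟩ = γ.cls k 1 := by
          rw [TwoCentralSeries.cls_eq_iff]
          exact (QuotientGroup.eq_one_iff _).2 hg
        rw [h0, TwoCentralSeries.cls_one, map_zero]
        exact zero_mem _
      comm_mem := by
        rintro k l g h ⟨hg, hg'⟩ ⟨hh, hh'⟩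
        refine ⟨γ.comm_mem hg hh, ?_⟩
        rw [← γ.lie_incl_cls ⟨g, hg⟩ ⟨h, hh⟩]
        exact T.lie_mem hg' hh'
      pow_two_mem := by
        rintro k g ⟨hg, hg'⟩
        refine ⟨γ.pow_two_mem hg, ?_⟩
        rw [← γ.sq_incl_cls ⟨g, hg⟩]
        exact T.sq_mem _ hg' }
  induction x using TwoCentralSeries.induction_on with
  | zero => exact zero_mem _
  | incl k g => exact (lowerTwoCentralSeries_le Δ k g.2).2
  | add x y hx hy => exact add_mem hx hy

theorem toGr_surjective (φ : RACGLie K →ₗ⁅ZMod 2⁆ (lowerTwoCentralSeries (RACG K)).GrSum)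
    (hsq : ∀ x, φ (sq x) = sq (φ x))
    (hgen : ∀ i, φ (RACGLie.gen K i) = deg1 _ (PresentedGroup.of i)) :
    Function.Surjective φ := by
  have mul : ∀ g h : RACG K, deg1 (lowerTwoCentralSeries (RACG K)) (g * h) =
      deg1 (lowerTwoCentralSeries (RACG K)) g + deg1 (lowerTwoCentralSeries (RACG K)) h := by
    intro g h
    rw [deg1, deg1, deg1, ← map_add, ← TwoCentralSeries.cls_mul]
    rfl
  have one : deg1 (lowerTwoCentralSeries (RACG K)) 1 = 0 := by
    rw [deg1]
    exact map_zero _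
  have inv : ∀ g : RACG K, deg1 (lowerTwoCentralSeries (RACG K)) g⁻¹ =
      - deg1 (lowerTwoCentralSeries (RACG K)) g := by
    intro g
    rw [deg1, deg1, ← map_neg, ← TwoCentralSeries.cls_inv]
    rfl
  intro x
  refine (φ.mem_range x).1 (mem_of_deg1_mem
    { φ.range with
      sq_mem := by
        rintro _ ⟨y, rfl⟩
        exact ⟨sq y, hsq y⟩ } (fun g => ?_) x)
  change deg1 _ g ∈ φ.range
  have hg : g ∈ Subgroup.closure (Set.range (PresentedGroup.of : Fin m → RACG K)) := by
    rw [PresentedGroup.closure_range_of]; trivial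
  induction hg using Subgroup.closure_induction with
  | mem g hg =>
    obtain ⟨i, rfl⟩ := hg
    exact ⟨RACGLie.gen K i, hgen i⟩
  | one => rw [one]; exact zero_mem _
  | mul g h _ _ hg hh => rw [mul]; exact add_mem hg hh
  | inv g _ hg => rw [inv]; exact neg_mem hg

end

end RACG

/-! ### The Magnus representation -/

namespace RACG

open TwoLieAlgebra Polynomial

section

variable {G : Type*} [Group G] {A : Type*} [Ring A]

theorem X_pow_add_mul_mul (k l : ℕ) (p q : A[X]) :
    X ^ (k + l) * (p * q) = X ^ k * p * (X ^ l * q) := by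
  rw [pow_add]
  simp only [mul_assoc]
  rw [← mul_assoc p, ← X_pow_mul, mul_assoc]

/-- The leading term of `μ (g, h) - 1` is the commutator of those of `μ g - 1` and `μ h - 1`. -/
theorem magnus_comm (μ : G →* A[X]) {g h : G} {k l : ℕ} {p q : A[X]} (hp : μ g = 1 + X ^ k * p)
    (hq : μ h = 1 + X ^ l * q) :
    μ (g⁻¹ * h⁻¹ * g * h) = 1 + X ^ (k + l) * (μ (g⁻¹ * h⁻¹) * (p * q - q * p)) := by
  have e : X ^ (k + l) * (p * q - q * p) = μ (g * h) - μ (h * g) := by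
    rw [mul_sub, X_pow_add_mul_mul, add_comm k l, X_pow_add_mul_mul, map_mul, map_mul, hp, hq]
    noncomm_ring
  have e3 : g⁻¹ * h⁻¹ * (h * g) = 1 := by group
  rw [← mul_assoc, X_pow_mul, mul_assoc (μ _) (X ^ _), e, mul_sub, ← map_mul, ← map_mul, e3,
    map_one, ← mul_assoc]
  abel

theorem magnus_sq [Algebra (ZMod 2) A] (μ : G →* A[X]) {g : G} {k : ℕ} {p : A[X]}
    (hp : μ g = 1 + X ^ k * p) :
    μ (g ^ 2) = 1 + X ^ (2 * k) * (p * p) := by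
  have e := ZModModule.add_self (X ^ k * p)
  rw [two_mul, X_pow_add_mul_mul, map_pow, hp, pow_two]
  calc _ = 1 + (X ^ k * p + X ^ k * p) + X ^ k * p * (X ^ k * p) := by noncomm_ring
    _ = _ := by rw [e, add_zero]

theorem magnus_mul (μ : G →* A[X]) {g h : G} {k : ℕ} {p q : A[X]} (hp : μ g = 1 + X ^ k * p)
    (hq : μ h = 1 + X ^ k * q) : μ (g * h) = 1 + X ^ k * (p + q + p * X ^ k * q) := by
  rw [map_mul, hp, hq]; noncomm_ring

theorem coeff_eq_coeff_zero {r p : A[X]} {k : ℕ+} (h : r = 1 + X ^ (k : ℕ) * p) :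
    r.coeff k = p.coeff 0 := by
  have h1 := coeff_X_pow_mul p (k : ℕ) 0
  rw [zero_add] at h1
  rw [h, coeff_add, h1, coeff_one, if_neg k.ne_zero, zero_add]

variable [Algebra (ZMod 2) A]

/-- The filtration of `G` defined by a homomorphism `μ` to the multiplicative monoid of `A[X]` with
all values congruent to `1` modulo `X`: its `k`-th term consists of the `g` with `μ g ≡ 1` modulo
`X ^ k`. -/
def magnusSeries (μ : G →* A[X]) (hμ : ∀ g, ∃ p, μ g = 1 + X * p) : TwoCentralSeries G where
  term k :=
    { carrier := {g | ∃ p, μ g = 1 + X ^ (k : ℕ) * p}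
      one_mem' := ⟨0, by simp⟩
      mul_mem' := by
        rintro g h ⟨p, hp⟩ ⟨q, hq⟩
        exact ⟨_, magnus_mul μ hp hq⟩
      inv_mem' := by
        rintro g ⟨p, hp⟩
        refine ⟨-p * μ g⁻¹, ?_⟩
        have h : μ g * μ g⁻¹ = 1 := by rw [← map_mul, mul_inv_cancel, map_one]
        have h2 : X ^ (k : ℕ) * p = μ g - 1 := by rw [hp]; abel
        rw [neg_mul, mul_neg, ← mul_assoc, h2, sub_mul, h]; noncomm_ring }
  term_one := by
    refine eq_top_iff.2 fun g _ => ?_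
    obtain ⟨p, hp⟩ := hμ g
    exact ⟨p, by rw [hp, PNat.one_coe, pow_one]⟩
  term_succ_le := by
    rintro k g ⟨p, hp⟩
    exact ⟨X * p, by rw [hp, PNat.add_coe, PNat.one_coe, pow_succ, mul_assoc]⟩
  comm_mem := by
    rintro k l g h ⟨p, hp⟩ ⟨q, hq⟩
    exact ⟨_, by rw [PNat.add_coe]; exact magnus_comm μ hp hq⟩
  pow_two_mem := by
    rintro k g ⟨p, hp⟩
    exact ⟨_, by rw [PNat.mul_coe]; exact magnus_sq μ hp⟩

/-- Leading coefficients define a homomorphism from the associated graded of the lower 2-central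
series to `A`, under which brackets become commutators and 2-powers become squares. -/
theorem exists_leadingCoeff (μ : G →* A[X]) (hμ : ∀ g, ∃ p, μ g = 1 + X * p) :
    ∃ φ : (lowerTwoCentralSeries G).GrSum →+ A, (∀ x, φ (sq x) = φ x * φ x) ∧
      (∀ x y, φ ⁅x, y⁆ = φ x * φ y + φ y * φ x) ∧
      ∀ k (g : (lowerTwoCentralSeries G).term k),
        φ ((lowerTwoCentralSeries G).incl k ((lowerTwoCentralSeries G).cls k g)) =
          (μ g).coeff k := by
  set γ := lowerTwoCentralSeries G
  have hγ : ∀ {k : ℕ+} {g : G}, g ∈ γ.term k → ∃ p, μ g = 1 + X ^ (k : ℕ) * p :=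
    fun {k g} hg => lowerTwoCentralSeries_le (magnusSeries μ hμ) k hg
  let lead (k : ℕ+) : γ.term k →* Multiplicative A :=
    { toFun := fun g => Multiplicative.ofAdd ((μ g).coeff k)
      map_one' := by
        rw [Subgroup.coe_one, map_one, coeff_one, if_neg k.ne_zero, ofAdd_zero]
      map_mul' := by
        intro g h
        obtain ⟨p, hp⟩ := hγ g.2
        obtain ⟨q, hq⟩ := hγ h.2
        rw [← ofAdd_add, Subgroup.coe_mul, coeff_eq_coeff_zero (magnus_mul μ hp hq),
          coeff_eq_coeff_zero hp, coeff_eq_coeff_zero hq, mul_assoc, X_pow_mul]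
        simp [k.pos.ne] }
  let φ : γ.GrSum →+ A := DirectSum.toAddMonoid fun k =>
    (MonoidHom.toAdditiveLeft (QuotientGroup.lift ((γ.term (k + 1)).subgroupOf (γ.term k))
      (lead k) (by
        intro g hg
        obtain ⟨p, hp⟩ := hγ (Subgroup.mem_subgroupOf.1 hg)
        rw [PNat.add_coe, PNat.one_coe, pow_succ, mul_assoc] at hp
        refine Multiplicative.toAdd.injective ?_
        change (μ g).coeff k = 0
        rw [coeff_eq_coeff_zero hp, mul_coeff_zero, coeff_X_zero, zero_mul])) : γ.Gr k →+ A)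
  have hφ : ∀ k (g : γ.term k), φ (γ.incl k (γ.cls k g)) = (μ g).coeff k := fun k g =>
    DirectSum.toAddMonoid_of (β := γ.Gr) _ k (γ.cls k g)
  have hμ0 : ∀ g, (μ g).coeff 0 = 1 := fun g => by
    obtain ⟨p, hp⟩ := hμ g
    rw [hp, coeff_add, mul_coeff_zero, coeff_X_zero, zero_mul, coeff_one_zero, add_zero]
  have hlie : ∀ x y, φ ⁅x, y⁆ = φ x * φ y + φ y * φ x := by
    intro x y
    induction x using TwoCentralSeries.induction_on with
    | zero => simp
    | add x x' h h' => rw [add_lie, map_add, map_add, h, h']; noncomm_ring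
    | incl k a =>
      induction y using TwoCentralSeries.induction_on with
      | zero => simp
      | add x x' h h' => rw [lie_add, map_add, map_add, h, h']; noncomm_ring
      | incl l b =>
        obtain ⟨p, hp⟩ := hγ a.2
        obtain ⟨q, hq⟩ := hγ b.2
        have hc := magnus_comm μ hp hq
        rw [← PNat.add_coe] at hc
        rw [TwoCentralSeries.lie_incl_cls, hφ, hφ, hφ, coeff_eq_coeff_zero hp,
          coeff_eq_coeff_zero hq, coeff_eq_coeff_zero hc, mul_coeff_zero, hμ0, one_mul, coeff_sub,
          mul_coeff_zero, mul_coeff_zero, ZModModule.sub_eq_add]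
  refine ⟨φ, fun x => ?_, hlie, hφ⟩
  induction x using TwoCentralSeries.induction_on with
  | zero => rw [sq_zero, map_zero, mul_zero]
  | add x y hx hy => rw [sq_add, map_add, map_add, map_add, hx, hy, hlie]; noncomm_ring
  | incl k a =>
    obtain ⟨p, hp⟩ := hγ a.2
    have hc := magnus_sq μ hp
    rw [show 2 * (k : ℕ) = ((2 * k : ℕ+) : ℕ) from rfl] at hc
    rw [TwoCentralSeries.sq_incl_cls, hφ, hφ, coeff_eq_coeff_zero hp, coeff_eq_coeff_zero hc,
      mul_coeff_zero]

end

section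

variable {m : ℕ} {K : AbstractSimplicialComplex (Fin m)}

variable (K) in
/-- The Magnus representation `a_i ↦ 1 + u_i X` of the right-angled Coxeter group over the
restricted enveloping algebra. -/
theorem exists_magnus : ∃ μ : RACG K →* (Env (RACGLie K))[X],
    (∀ g, ∃ p, μ g = 1 + X * p) ∧
      ∀ i, μ (PresentedGroup.of i) = 1 + X * C (envι (RACGLie.gen K i)) := by
  set A := Env (RACGLie K)
  have two : ∀ p : A[X], p + p = 0 := fun p => ZModModule.add_self p
  let v : Fin m → A[X] := fun i => 1 + X * C (envι (RACGLie.gen K i))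
  have vv : ∀ i j, v i * v j = 1 + X * C (envι (RACGLie.gen K i)) +
      X * C (envι (RACGLie.gen K j)) +
      X ^ 2 * C (envι (RACGLie.gen K i) * envι (RACGLie.gen K j)) := by
    intro i j
    have := X_pow_add_mul_mul 1 1 (C (envι (RACGLie.gen K i))) (C (envι (RACGLie.gen K j)))
    rw [pow_one] at this
    rw [C_mul, this]
    simp only [v]
    noncomm_ring
  have vsq : ∀ i, v i * v i = 1 := by
    intro i
    rw [vv, envι_mul_self, RACGLie.sq_gen, map_zero, C_0, mul_zero, add_zero, add_assoc, two,
      add_zero]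
  let a : Fin m → (A[X])ˣ := fun i => ⟨v i, v i, vsq i, vsq i⟩
  have ha : ∀ r ∈ racgRels K, FreeGroup.lift a r = 1 := by
    rintro _ (⟨i, rfl⟩ | ⟨i, j, hij, rfl⟩)
    · rw [map_pow, FreeGroup.lift_apply_of, pow_two]
      exact Units.ext (vsq i)
    · simp only [map_mul, map_inv, FreeGroup.lift_apply_of]
      have hc : a i * a j = a j * a i := by
        refine Units.ext ?_
        change v i * v j = v j * v i
        have h : envι (RACGLie.gen K i) * envι (RACGLie.gen K j) =
            envι (RACGLie.gen K j) * envι (RACGLie.gen K i) := by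
          have h1 := envι_lie (RACGLie.gen K i) (RACGLie.gen K j)
          rw [RACGLie.lie_gen hij, map_zero, eq_comm, ← ZModModule.sub_eq_add, sub_eq_zero] at h1
          exact h1
        rw [vv, vv, h]; abel
      rw [mul_assoc, hc]; group
  refine ⟨(Units.coeHom _).comp (PresentedGroup.toGroup ha), ?_, ?_⟩
  · intro g
    have hg : g ∈ Subgroup.closure (Set.range (PresentedGroup.of : Fin m → RACG K)) := by
      rw [PresentedGroup.closure_range_of]; trivial
    induction hg using Subgroup.closure_induction'' with
    | mem g hg =>
      obtain ⟨i, rfl⟩ := hg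
      exact ⟨C (envι (RACGLie.gen K i)), by
        rw [MonoidHom.comp_apply, PresentedGroup.toGroup.of]; rfl⟩
    | inv_mem g hg =>
      obtain ⟨i, rfl⟩ := hg
      exact ⟨C (envι (RACGLie.gen K i)), by
        rw [MonoidHom.comp_apply, map_inv, PresentedGroup.toGroup.of]; rfl⟩
    | one => exact ⟨0, by simp⟩
    | mul g h _ _ hg hh =>
      obtain ⟨p, hp⟩ := hg
      obtain ⟨q, hq⟩ := hh
      have := magnus_mul (g := g) (h := h) (k := 1) (p := p) (q := q) _ (by rwa [pow_one])
        (by rwa [pow_one])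
      rw [pow_one] at this
      exact ⟨_, this⟩
  · intro i
    rw [MonoidHom.comp_apply, PresentedGroup.toGroup.of]; rfl

/-- The composite of the homomorphism to the associated graded with the leading coefficients is the
canonical map to the restricted enveloping algebra. -/
theorem envι_eq_zero_of_toGr_eq_zero
    (φ : RACGLie K →ₗ⁅ZMod 2⁆ (lowerTwoCentralSeries (RACG K)).GrSum)
    (hsq : ∀ x, φ (sq x) = sq (φ x))
    (hgen : ∀ i, φ (RACGLie.gen K i) = deg1 _ (PresentedGroup.of i)) {x : RACGLie K}
    (hx : φ x = 0) : envι x = 0 := by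
  obtain ⟨μ, hμ, μgen⟩ := exists_magnus K
  obtain ⟨lc, lcsq, lclie, lccls⟩ := exists_leadingCoeff μ hμ
  have h : ∀ x, lc (φ x) = envι x := by
    intro x
    induction x using RACGLie.induction with
    | gen i =>
      rw [hgen, deg1, lccls]
      change (μ (PresentedGroup.of i)).coeff 1 = _
      rw [μgen, coeff_add, coeff_X_mul, coeff_C_zero, coeff_one, if_neg one_ne_zero, zero_add]
    | zero => rw [map_zero, map_zero, map_zero]
    | add x y hx hy => rw [map_add, map_add, map_add, hx, hy]
    | lie x y hx hy => rw [LieHom.map_lie, lclie, hx, hy, envι_lie]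
    | sq x hx => rw [hsq, lcsq, hx, envι_mul_self]
  rw [← h, hx, map_zero]

end

end RACG

/-! ### Extension of scalars of 2-Lie algebras -/

namespace TwoLieAlgebra

open scoped TensorProduct
open Polynomial

section

variable {L : Type*} [LieRing L] [LieAlgebra (ZMod 2) L] [TwoLieAlgebra L]

variable (L) in
/-- The 2-power operation is a quadratic map, so it is the diagonal of a bilinear map. -/
theorem exists_bilin_self_eq_sq : ∃ B : LinearMap.BilinMap (ZMod 2) L L, ∀ x, B x x = sq x := by
  let Q : QuadraticMap (ZMod 2) L L :=
    { toFun := sq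
      toFun_smul := fun a x => by rw [sq_smul, pow_two]
      exists_companion' := ⟨(LieModule.toEnd (ZMod 2) L L : L →ₗ[ZMod 2] Module.End (ZMod 2) L),
        fun x y => sq_add x y⟩ }
  obtain ⟨B, hB⟩ := LinearMap.BilinMap.toQuadraticMap_surjective Q
  exact ⟨B, fun x => congrArg (fun q : QuadraticMap (ZMod 2) L L => q x) hB⟩

variable (L) in
/-- A (non-canonical) bilinear map with diagonal the 2-power operation. -/
noncomputable def sqBilin : LinearMap.BilinMap (ZMod 2) L L := (exists_bilin_self_eq_sq L).choose

theorem sqBilin_self (x : L) : sqBilin L x x = sq x := (exists_bilin_self_eq_sq L).choose_spec x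

theorem sqBilin_add_swap (x y : L) : sqBilin L x y + sqBilin L y x = ⁅x, y⁆ := by
  have h := sq_add x y
  rw [← sqBilin_self, ← sqBilin_self, ← sqBilin_self, map_add, map_add, LinearMap.add_apply,
    LinearMap.add_apply] at h
  refine add_left_cancel (a := sqBilin L x x + sqBilin L y y) ?_
  rw [← h]; abel

/-- The extension of scalars `R ⊗ L` from `𝔽₂` to a commutative algebra `R`. -/
abbrev ScalarExt (R L : Type*) [CommRing R] [Algebra (ZMod 2) R] [LieRing L]
    [LieAlgebra (ZMod 2) L] : Type _ := R ⊗[ZMod 2] L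

variable {R : Type*} [CommRing R] [Algebra (ZMod 2) R]

/-- The 2-power operation on the extension of scalars `R ⊗ L`, with
`(r ⊗ x)^[2] = r² ⊗ x^[2]`. -/
noncomputable def tensorSq (z : R ⊗[ZMod 2] L) : R ⊗[ZMod 2] L := (sqBilin L).baseChange R z z

theorem tensorSq_tmul (r : R) (x : L) : tensorSq (r ⊗ₜ[ZMod 2] x) = (r * r) ⊗ₜ sq x := by
  rw [tensorSq, LinearMap.BilinMap.baseChange_tmul, sqBilin_self]

theorem baseChange_add_swap (z w : R ⊗[ZMod 2] L) :
    (sqBilin L).baseChange R z w + (sqBilin L).baseChange R w z = ⁅z, w⁆ := by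
  induction z using TensorProduct.induction_on with
  | zero => simp
  | add z z' h h' => rw [add_lie, ← h, ← h', map_add, map_add, LinearMap.add_apply]; abel
  | tmul r x =>
    induction w using TensorProduct.induction_on with
    | zero => simp
    | add z z' h h' => rw [lie_add, ← h, ← h', map_add, map_add, LinearMap.add_apply]; abel
    | tmul s y =>
      rw [LinearMap.BilinMap.baseChange_tmul, LinearMap.BilinMap.baseChange_tmul, mul_comm s r,
        ← TensorProduct.tmul_add, sqBilin_add_swap, LieAlgebra.ExtendScalars.bracket_tmul]

theorem tensorSq_add (z w : R ⊗[ZMod 2] L) :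
    tensorSq (z + w) = tensorSq z + tensorSq w + ⁅z, w⁆ := by
  rw [← baseChange_add_swap, tensorSq, tensorSq, tensorSq, map_add, map_add, LinearMap.add_apply,
    LinearMap.add_apply]
  abel

theorem tensorSq_smul (r : R) (z : R ⊗[ZMod 2] L) : tensorSq (r • z) = (r * r) • tensorSq z := by
  rw [tensorSq, tensorSq, map_smul, map_smul, LinearMap.smul_apply, smul_smul]

/-- Both sides have the same additivity defect in `w`, so it is enough to treat pure tensors. -/
theorem lie_tensorSq (z w : R ⊗[ZMod 2] L) : ⁅z, tensorSq w⁆ = ⁅⁅z, w⁆, w⁆ := by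
  induction w using TensorProduct.induction_on with
  | zero => rw [tensorSq, map_zero, lie_zero, lie_zero]
  | add w w' h h' =>
    rw [tensorSq_add, lie_add, lie_add, h, h', leibniz_lie, lie_comm w ⁅z, w'⁆]
    simp only [add_lie, lie_add]
    abel
  | tmul s y =>
    rw [tensorSq_tmul]
    induction z using TensorProduct.induction_on with
    | zero => simp
    | add z z' h h' => rw [add_lie, h, h', add_lie, add_lie]
    | tmul r x =>
      rw [LieAlgebra.ExtendScalars.bracket_tmul, LieAlgebra.ExtendScalars.bracket_tmul,
        LieAlgebra.ExtendScalars.bracket_tmul, TwoLieAlgebra.lie_sq, mul_assoc]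

noncomputable instance : TwoLieAlgebra (R ⊗[ZMod 2] L) where
  sq := tensorSq
  lie_sq := lie_tensorSq
  sq_smul a z := by
    have h := tensorSq_smul (algebraMap (ZMod 2) R a) z
    rw [← map_mul, algebraMap_smul, algebraMap_smul] at h
    rw [h, pow_two]
  sq_add := tensorSq_add

theorem sq_tmul (r : R) (x : L) : sq (r ⊗ₜ[ZMod 2] x) = (r * r) ⊗ₜ[ZMod 2] sq x :=
  tensorSq_tmul r x

theorem sq_base_smul (r : R) (z : R ⊗[ZMod 2] L) : sq (r • z) = (r * r) • sq z :=
  tensorSq_smul r z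

end

section

variable {L : Type*} [LieRing L] [LieAlgebra (ZMod 2) L]

variable (L) in
/-- Extension of scalars from `𝔽₂` to `𝔽₂[X]`. -/
abbrev PolyExt : Type _ := ScalarExt (ZMod 2)[X] L

/-- The coefficient of `X ^ n` of an element of `𝔽₂[X] ⊗ L`. -/
noncomputable def tcoeff (n : ℕ) : PolyExt L →ₗ[ZMod 2] L :=
  (TensorProduct.lid (ZMod 2) L).toLinearMap ∘ₗ LinearMap.rTensor L (lcoeff (ZMod 2) n)

theorem tcoeff_tmul (n : ℕ) (r : (ZMod 2)[X]) (x : L) : tcoeff n (r ⊗ₜ x) = r.coeff n • x := rfl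

/-- The value at `X = 1` of an element of `𝔽₂[X] ⊗ L`. -/
noncomputable def teval : PolyExt L →ₗ[ZMod 2] L :=
  (TensorProduct.lid (ZMod 2) L).toLinearMap ∘ₗ
    LinearMap.rTensor L (Polynomial.aeval (1 : ZMod 2)).toLinearMap

theorem teval_tmul (r : (ZMod 2)[X]) (x : L) : teval (r ⊗ₜ x) = r.eval 1 • x := by
  rw [← Polynomial.coe_aeval_eq_eval]; rfl

theorem tcoeff_X_pow_smul_of_lt {n k : ℕ} (h : n < k) (z : PolyExt L) :
    tcoeff n ((X ^ k : (ZMod 2)[X]) • z) = 0 := by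
  induction z using TensorProduct.induction_on with
  | zero => rw [smul_zero, map_zero]
  | add z w hz hw => rw [smul_add, map_add, hz, hw, add_zero]
  | tmul r x =>
    rw [TensorProduct.smul_tmul', tcoeff_tmul, smul_eq_mul, coeff_X_pow_mul', if_neg h.not_ge,
      zero_smul]

theorem tcoeff_X_pow_smul (n : ℕ) (z : PolyExt L) :
    tcoeff n ((X ^ n : (ZMod 2)[X]) • z) = tcoeff 0 z := by
  induction z using TensorProduct.induction_on with
  | zero => rw [smul_zero, map_zero, map_zero]
  | add z w hz hw => rw [smul_add, map_add, map_add, hz, hw]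
  | tmul r x =>
    rw [TensorProduct.smul_tmul', tcoeff_tmul, tcoeff_tmul, smul_eq_mul, coeff_X_pow_mul',
      if_pos le_rfl, Nat.sub_self]

/-- An element is its constant coefficient plus a multiple of `X`. -/
theorem exists_eq_add_X_smul (z : PolyExt L) :
    ∃ w, z = 1 ⊗ₜ tcoeff 0 z + (X : (ZMod 2)[X]) • w := by
  induction z using TensorProduct.induction_on with
  | zero => exact ⟨0, by simp⟩
  | add z w hz hw =>
    obtain ⟨z', hz⟩ := hz
    obtain ⟨w', hw⟩ := hw
    refine ⟨z' + w', ?_⟩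
    rw [map_add, TensorProduct.tmul_add, smul_add]
    nth_rw 1 [hz, hw]
    abel
  | tmul r x =>
    refine ⟨r.divX ⊗ₜ x, ?_⟩
    rw [TensorProduct.smul_tmul', tcoeff_tmul, ← TensorProduct.smul_tmul, ← TensorProduct.add_tmul,
      smul_eq_mul, smul_eq_C_mul, mul_one]
    rw [add_comm, X_mul_divX_add]

theorem exists_teval_eq_sum (z : PolyExt L) :
    ∃ N, ∀ M ≥ N, teval z = ∑ k ∈ Finset.range M, tcoeff k z := by
  induction z using TensorProduct.induction_on with
  | zero => exact ⟨0, fun M _ => by simp⟩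
  | add z w hz hw =>
    obtain ⟨N, hz⟩ := hz
    obtain ⟨N', hw⟩ := hw
    refine ⟨max N N', fun M hM => ?_⟩
    rw [map_add, hz M (le_of_max_le_left hM), hw M (le_of_max_le_right hM),
      ← Finset.sum_add_distrib]
    simp only [map_add]
  | tmul r x =>
    refine ⟨r.natDegree + 1, fun M hM => ?_⟩
    simp only [teval_tmul, tcoeff_tmul, ← Finset.sum_smul]
    rw [eval_eq_sum_range' (Nat.lt_of_succ_le hM)]
    simp

theorem teval_eq_zero {z : PolyExt L} (h : ∀ n, tcoeff n z = 0) : teval z = 0 := by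
  obtain ⟨N, hN⟩ := exists_teval_eq_sum z
  rw [hN N le_rfl]
  exact Finset.sum_eq_zero fun k _ => h k

theorem teval_lie (z w : PolyExt L) : teval ⁅z, w⁆ = ⁅teval z, teval w⁆ := by
  induction z using TensorProduct.induction_on with
  | zero => simp
  | add z z' h h' => rw [add_lie, map_add, h, h', map_add, add_lie]
  | tmul r x =>
    induction w using TensorProduct.induction_on with
    | zero => simp
    | add z z' h h' => rw [lie_add, map_add, h, h', map_add, lie_add]
    | tmul s y =>
      rw [LieAlgebra.ExtendScalars.bracket_tmul, teval_tmul, teval_tmul, teval_tmul, eval_mul,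
        smul_lie, lie_smul, smul_smul]

theorem teval_sq [TwoLieAlgebra L] (z : PolyExt L) :
    teval (sq z) = sq (teval z) := by
  induction z using TensorProduct.induction_on with
  | zero => rw [sq_zero, map_zero, sq_zero]
  | add z z' h h' => rw [sq_add, map_add, map_add, map_add, h, h', teval_lie, sq_add]
  | tmul r x => rw [sq_tmul, teval_tmul, teval_tmul, eval_mul, sq_smul, pow_two]

end

end TwoLieAlgebra

/-! ### The grading of the presented 2-Lie algebra -/

namespace RACGLie

open TwoLieAlgebra
open scoped TensorProduct Polynomial

section

variable {m : ℕ} {K : AbstractSimplicialComplex (Fin m)}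

variable (K) in
/-- The grading of the presented 2-Lie algebra, as the homomorphism `u_i ↦ X ⊗ u_i` to its extension
of scalars to `𝔽₂[X]`. -/
theorem exists_weight : ∃ θ : RACGLie K →ₗ⁅ZMod 2⁆ PolyExt (RACGLie K),
    (∀ x, θ (sq x) = sq (θ x)) ∧ ∀ i, θ (gen K i) = (Polynomial.X : (ZMod 2)[X]) ⊗ₜ gen K i := by
  refine exists_lift _ (fun i => ?_) fun i j hij => ?_
  · rw [sq_tmul, sq_gen, TensorProduct.tmul_zero]
  · rw [LieAlgebra.ExtendScalars.bracket_tmul, lie_gen hij, TensorProduct.tmul_zero]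

variable (K) in
/-- The weight homomorphism `u_i ↦ X ⊗ u_i`. An element is homogeneous of degree `n` if it is mapped
to `X ^ n ⊗ x`. -/
noncomputable def weight : RACGLie K →ₗ⁅ZMod 2⁆ PolyExt (RACGLie K) := (exists_weight K).choose

theorem weight_sq (x : RACGLie K) : weight K (sq x) = sq (weight K x) :=
  (exists_weight K).choose_spec.1 x

theorem weight_gen (i : Fin m) :
    weight K (gen K i) = (Polynomial.X : (ZMod 2)[X]) ⊗ₜ gen K i :=
  (exists_weight K).choose_spec.2 i

theorem teval_weight (x : RACGLie K) : teval (weight K x) = x := by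
  induction x using RACGLie.induction with
  | gen i => rw [weight_gen, teval_tmul, Polynomial.eval_X, one_smul]
  | zero => rw [map_zero, map_zero]
  | add x y hx hy => rw [map_add, map_add, hx, hy]
  | lie x y hx hy => rw [LieHom.map_lie, teval_lie, hx, hy]
  | sq x hx => rw [weight_sq, teval_sq, hx]

/-- The monomials of degree `n` in the generators: iterated brackets and 2-powers. -/
inductive IsMonomial : ℕ → RACGLie K → Prop
  | gen (i : Fin m) : IsMonomial 1 (gen K i)
  | lie {k l : ℕ} {x y : RACGLie K} : IsMonomial k x → IsMonomial l y → IsMonomial (k + l) ⁅x, y⁆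
  | sq {k : ℕ} {x : RACGLie K} : IsMonomial k x → IsMonomial (k + k) (sq x)

theorem IsMonomial.pos {n : ℕ} {x : RACGLie K} (h : IsMonomial n x) : 0 < n := by
  induction h with
  | gen i => exact one_pos
  | lie _ _ h _ => exact Nat.add_pos_left h _
  | sq _ h => exact Nat.add_pos_left h _

theorem finite_isMonomial (n : ℕ) : {x : RACGLie K | IsMonomial n x}.Finite := by
  induction n using Nat.strong_induction_on with
  | _ n ih =>
    refine Set.Finite.subset (s := Set.range (gen K) ∪
      ((⋃ k ∈ Set.Iio n, ⋃ l ∈ Set.Iio n,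
        Set.image2 (fun x y : RACGLie K => ⁅x, y⁆) {x | IsMonomial k x} {x | IsMonomial l x}) ∪
      ⋃ k ∈ Set.Iio n, TwoLieAlgebra.sq '' {x : RACGLie K | IsMonomial k x})) ?_ ?_
    · refine (Set.finite_range _).union (Set.Finite.union ?_ ?_)
      · exact (Set.finite_Iio n).biUnion fun k hk => (Set.finite_Iio n).biUnion fun l hl =>
          (ih k hk).image2 _ (ih l hl)
      · exact (Set.finite_Iio n).biUnion fun k hk => (ih k hk).image _
    · intro x hx
      cases hx with
      | gen i => exact Or.inl ⟨i, rfl⟩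
      | lie hx hy =>
        refine Or.inr (Or.inl ?_)
        simp only [Set.mem_iUnion]
        exact ⟨_, Nat.lt_add_of_pos_right hy.pos, _, Nat.lt_add_of_pos_left hx.pos,
          Set.mem_image2_of_mem hx hy⟩
      | sq hx =>
        refine Or.inr (Or.inr ?_)
        simp only [Set.mem_iUnion]
        exact ⟨_, Nat.lt_add_of_pos_right hx.pos, Set.mem_image_of_mem _ hx⟩

variable (K) in
/-- The span of the monomials of degree `n`. -/
def homog (n : ℕ) : Submodule (ZMod 2) (RACGLie K) := Submodule.span _ {x | IsMonomial n x}

instance (n : ℕ) : Module.Finite (ZMod 2) (homog K n) :=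
  Module.Finite.span_of_finite _ (finite_isMonomial n)

variable (K) in
/-- The span of the elements `X ^ n ⊗ x` of `𝔽₂[X] ⊗ L` with `x` a monomial of degree `n`. -/
noncomputable def gradedSpan : Submodule (ZMod 2) (PolyExt (RACGLie K)) :=
  Submodule.span (ZMod 2)
    {z | ∃ n x, IsMonomial n x ∧ z = ((Polynomial.X : (ZMod 2)[X]) ^ n) ⊗ₜ x}

theorem lie_mem_gradedSpan {z w : PolyExt (RACGLie K)} (hz : z ∈ gradedSpan K)
    (hw : w ∈ gradedSpan K) : ⁅z, w⁆ ∈ gradedSpan K := by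
  induction hz, hw using Submodule.span_induction₂ with
  | mem_mem z w hz hw =>
    obtain ⟨k, x, hx, rfl⟩ := hz
    obtain ⟨l, y, hy, rfl⟩ := hw
    refine Submodule.subset_span ⟨k + l, _, hx.lie hy, ?_⟩
    rw [LieAlgebra.ExtendScalars.bracket_tmul, pow_add]
  | zero_left => rw [zero_lie]; exact zero_mem _
  | zero_right => rw [lie_zero]; exact zero_mem _
  | add_left _ _ _ _ _ _ h h' => rw [add_lie]; exact add_mem h h'
  | add_right _ _ _ _ _ _ h h' => rw [lie_add]; exact add_mem h h'
  | smul_left r _ _ _ _ h => rw [smul_lie]; exact Submodule.smul_mem _ _ h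
  | smul_right r _ _ _ _ h => rw [lie_smul]; exact Submodule.smul_mem _ _ h

theorem sq_mem_gradedSpan {z : PolyExt (RACGLie K)} (hz : z ∈ gradedSpan K) :
    sq z ∈ gradedSpan K := by
  induction hz using Submodule.span_induction with
  | mem z hz =>
    obtain ⟨k, x, hx, rfl⟩ := hz
    refine Submodule.subset_span ⟨k + k, _, hx.sq, ?_⟩
    rw [sq_tmul, pow_add]
  | zero => rw [sq_zero]; exact zero_mem _
  | add z w hz hw h h' =>
    rw [sq_add]
    exact add_mem (add_mem h h') (lie_mem_gradedSpan hz hw)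
  | smul r z _ h => rw [sq_smul]; exact Submodule.smul_mem _ _ h

theorem weight_mem_gradedSpan (x : RACGLie K) : weight K x ∈ gradedSpan K := by
  induction x using RACGLie.induction with
  | gen i => exact Submodule.subset_span ⟨1, _, .gen i, by rw [weight_gen, pow_one]⟩
  | zero => rw [map_zero]; exact zero_mem _
  | add x y hx hy => rw [map_add]; exact add_mem hx hy
  | lie x y hx hy => rw [LieHom.map_lie]; exact lie_mem_gradedSpan hx hy
  | sq x hx => rw [weight_sq]; exact sq_mem_gradedSpan hx

variable (K) in
/-- The projection to the homogeneous component of degree `n`. -/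
noncomputable def homogProj (n : ℕ) : RACGLie K →ₗ[ZMod 2] RACGLie K :=
  tcoeff n ∘ₗ (weight K : RACGLie K →ₗ[ZMod 2] PolyExt (RACGLie K))

theorem homogProj_apply (n : ℕ) (x : RACGLie K) : homogProj K n x = tcoeff n (weight K x) := rfl

theorem homogProj_mem (n : ℕ) (x : RACGLie K) : homogProj K n x ∈ homog K n := by
  rw [homogProj_apply]
  have h := weight_mem_gradedSpan x
  generalize weight K x = z at h
  induction h using Submodule.span_induction with
  | mem z hz =>
    obtain ⟨k, x, hx, rfl⟩ := hz
    rw [tcoeff_tmul, Polynomial.coeff_X_pow]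
    split_ifs with hn
    · rw [one_smul]; exact Submodule.subset_span (hn ▸ hx)
    · rw [zero_smul]; exact zero_mem _
  | zero => rw [map_zero]; exact zero_mem _
  | add z w _ _ h h' => rw [map_add]; exact add_mem h h'
  | smul r z _ h => rw [map_smul]; exact Submodule.smul_mem _ _ h

theorem homogProj_zero (x : RACGLie K) : homogProj K 0 x = 0 := by
  have h := homogProj_mem 0 x
  have h0 : {x : RACGLie K | IsMonomial 0 x} = ∅ :=
    Set.eq_empty_iff_forall_notMem.2 fun y hy => hy.pos.false
  rwa [homog, h0, Submodule.span_empty, Submodule.mem_bot] at h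

theorem eq_zero_of_homogProj {x : RACGLie K} (h : ∀ n, homogProj K n x = 0) : x = 0 := by
  rw [← teval_weight x]
  exact teval_eq_zero h

variable (K) in
/-- The elements all of whose homogeneous components have degree at least `n`. -/
def degGE (n : ℕ) : TwoLieSubalgebra (RACGLie K) where
  carrier := {x | ∃ z, weight K x = ((Polynomial.X : (ZMod 2)[X]) ^ n) • z}
  zero_mem' := ⟨0, by rw [map_zero, smul_zero]⟩
  add_mem' := by
    rintro x y ⟨z, hz⟩ ⟨w, hw⟩
    exact ⟨z + w, by rw [map_add, hz, hw, smul_add]⟩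
  smul_mem' := by
    rintro r x ⟨z, hz⟩
    exact ⟨r • z, by rw [map_smul, hz, smul_comm]⟩
  lie_mem' := by
    rintro x y ⟨z, hz⟩ ⟨w, hw⟩
    exact ⟨_, by rw [LieHom.map_lie, hz, hw, smul_lie]⟩
  sq_mem := by
    rintro x ⟨z, hz⟩
    exact ⟨_, by rw [weight_sq, hz, sq_base_smul, mul_smul]⟩

theorem homogProj_eq_zero_of_mem_degGE {n k : ℕ} (h : n < k) {x : RACGLie K}
    (hx : x ∈ (degGE K k).toLieSubalgebra) : homogProj K n x = 0 := by
  obtain ⟨z, hz⟩ := hx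
  rw [homogProj_apply, hz, tcoeff_X_pow_smul_of_lt h]

theorem mem_degGE_succ {n : ℕ} {x : RACGLie K} (hx : x ∈ (degGE K n).toLieSubalgebra)
    (h : homogProj K n x = 0) : x ∈ (degGE K (n + 1)).toLieSubalgebra := by
  obtain ⟨z, hz⟩ := hx
  obtain ⟨w, hw⟩ := exists_eq_add_X_smul z
  rw [homogProj_apply, hz, tcoeff_X_pow_smul] at h
  rw [h, TensorProduct.tmul_zero, zero_add] at hw
  exact ⟨w, by rw [hz, hw, smul_smul, pow_succ]⟩

theorem mem_degGE_one (x : RACGLie K) : x ∈ (degGE K 1).toLieSubalgebra :=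
  mem_degGE_succ ⟨weight K x, by rw [pow_zero, one_smul]⟩ (homogProj_zero x)

theorem lie_mem_degGE_add {n k : ℕ} {x y : RACGLie K} (hx : x ∈ (degGE K n).toLieSubalgebra)
    (hy : y ∈ (degGE K k).toLieSubalgebra) : ⁅x, y⁆ ∈ (degGE K (n + k)).toLieSubalgebra := by
  obtain ⟨z, hz⟩ := hx
  obtain ⟨w, hw⟩ := hy
  exact ⟨_, by rw [LieHom.map_lie, hz, hw, smul_lie, lie_smul, smul_smul, pow_add]⟩

theorem sq_mem_degGE_add {n : ℕ} {x : RACGLie K} (hx : x ∈ (degGE K n).toLieSubalgebra) :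
    sq x ∈ (degGE K (n + n)).toLieSubalgebra := by
  obtain ⟨z, hz⟩ := hx
  exact ⟨_, by rw [weight_sq, hz, sq_base_smul, pow_add]⟩

/-! ### The embedding in the restricted enveloping algebra -/

/-- Since the homogeneous component of degree `n` is finite, `L_{≥ n+1}` is cut out in `L_{≥ n}` by
finitely many linear forms. For `n ≥ 1` these are restricted characters of `L_{≥ n}`, because
brackets and 2-powers of elements of `L_{≥ n}` have degree at least `2n > n`. -/
theorem envKer_degGE_subset {n : ℕ} (hn : 0 < n) :
    (degGE K n).envKer ⊆ (degGE K (n + 1)).envKer := by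
  let form (f : Module.Dual (ZMod 2) (homog K n)) : RACGLie K →ₗ[ZMod 2] ZMod 2 :=
    f ∘ₗ LinearMap.codRestrict (homog K n) (homogProj K n) (homogProj_mem n)
  have form_eq_zero : ∀ f {x}, homogProj K n x = 0 → form f x = 0 := by
    intro f x hx
    change f ⟨homogProj K n x, _⟩ = 0
    rw [← map_zero f]
    exact congrArg f (Subtype.ext hx)
  have key : ∀ s : Set (Module.Dual (ZMod 2) (homog K n)), s.Finite →
      ∃ S : TwoLieSubalgebra (RACGLie K), S.toLieSubalgebra ≤ (degGE K n).toLieSubalgebra ∧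
        (degGE K n).envKer ⊆ S.envKer ∧ ∀ f ∈ s, ∀ x ∈ S.toLieSubalgebra, form f x = 0 := by
    intro s hs
    induction s, hs using Set.Finite.induction_on with
    | empty => exact ⟨degGE K n, le_rfl, subset_rfl, fun f hf => absurd hf (Set.notMem_empty f)⟩
    | @insert f s _ _ ih =>
      obtain ⟨S, hS, hker, hform⟩ := ih
      have hlie : ∀ x ∈ S.toLieSubalgebra, ∀ y ∈ S.toLieSubalgebra, form f ⁅x, y⁆ = 0 :=
        fun x hx y hy => form_eq_zero f (homogProj_eq_zero_of_mem_degGE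
          (Nat.lt_add_of_pos_right hn) (lie_mem_degGE_add (hS hx) (hS hy)))
      have hsq : ∀ x ∈ S.toLieSubalgebra, form f (sq x) = 0 :=
        fun x hx => form_eq_zero f (homogProj_eq_zero_of_mem_degGE
          (Nat.lt_add_of_pos_right hn) (sq_mem_degGE_add (hS hx)))
      refine ⟨S.kerInf (form f) hlie hsq, fun x hx => hS hx.1,
        hker.trans (S.envKer_subset_envKer_kerInf (form f) hlie hsq), ?_⟩
      rintro g (rfl | hg) x hx
      · exact hx.2
      · exact hform g hg x hx.1
  have : Finite (Module.Dual (ZMod 2) (homog K n)) := Module.finite_of_finite (ZMod 2)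
  obtain ⟨S, hS, hker, hform⟩ := key Set.univ Set.finite_univ
  refine hker.trans (TwoLieSubalgebra.envKer_mono fun x hx => mem_degGE_succ (hS hx) ?_)
  have h0 : (⟨homogProj K n x, homogProj_mem n x⟩ : homog K n) = 0 :=
    (Module.forall_dual_apply_eq_zero_iff (ZMod 2) _).1 fun f => hform f (Set.mem_univ f) x hx
  exact congrArg Subtype.val h0

/-- The Poincaré–Birkhoff–Witt theorem for the presented 2-Lie algebra: it embeds in its restricted
enveloping algebra. -/
theorem envι_injective : Function.Injective (envι : RACGLie K →ₗ[ZMod 2] Env (RACGLie K)) := by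
  refine (injective_iff_map_eq_zero _).2 fun x hx => eq_zero_of_homogProj fun n => ?_
  have h : ∀ n, x ∈ (degGE K (n + 1)).envKer := by
    intro n
    induction n with
    | zero =>
      refine ⟨mem_degGE_one x, ?_⟩
      exact envι_map_eq_zero (L := RACGLie K) (M := (degGE K 1).toLieSubalgebra)
        (LinearMap.codRestrict (degGE K 1).toSubmodule LinearMap.id mem_degGE_one)
        (fun _ => rfl) hx
    | succ n ih => exact envKer_degGE_subset (Nat.succ_pos n) ih
  exact homogProj_eq_zero_of_mem_degGE (Nat.lt_succ_self n) (h n).1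

end

end RACGLie

/-! ### The isomorphism -/

theorem theorem5p4 (m : ℕ) (K : AbstractSimplicialComplex (Fin m)) :
    ∃ e : (lowerTwoCentralSeries (RACG K)).GrSum ≃ₗ⁅ZMod 2⁆ RACGLie K,
      ∀ x, e (TwoLieAlgebra.sq x) = TwoLieAlgebra.sq (e x) := by
  obtain ⟨φ, hsq, hgen⟩ := RACG.exists_toGr K
  have hinj : Function.Injective φ := (injective_iff_map_eq_zero φ).2 fun x hx =>
    RACGLie.envι_injective
      ((RACG.envι_eq_zero_of_toGr_eq_zero φ hsq hgen hx).trans (map_zero _).symm)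
  let e := LieEquiv.ofBijective φ ⟨hinj, RACG.toGr_surjective φ hsq hgen⟩
  refine ⟨e.symm, fun x => e.injective ?_⟩
  refine (e.apply_symm_apply _).trans ?_
  change _ = φ (TwoLieAlgebra.sq (e.symm x))
  rw [hsq]
  exact congrArg TwoLieAlgebra.sq (e.apply_symm_apply x).symm
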